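/- Let $n\ge 2$ be an integer and $\varepsilon>0$. Then there are a smooth Riemannian metric $g$ on the sphere $S^n$ and a smooth isometric embedding $\mathscr I:(S^n,g)\to\mathbb R^{n+1}$ (that is, $\mathscr I$ is smooth and injective, and $g(u,v)=\langle d\mathscr I(u),d\mathscr I(v)\rangle$ for all tangent vectors $u,v$) such that all sectional curvatures satisfy $K(g)\ge 1$ and $$\mathrm{Diam}_{\mathscr I}(S^n,g):=\sup_{x,y\in S^n}|\mathscr I(x)-\mathscr I(y)|\ \ge\ \pi-\varepsilon .$$ Moreover, $g$ and $\mathscr I$ can be chosen rotationally symmetric: with $O(n)$ denoting the group of linear isometries of $\mathbb R^{n+1}$ that fix the last coordinate vector, $g$ is $O(n)$-invariant, $\mathscr I$ is $O(n)$-equivariant, and $$\mathscr I(S^n)=\Big\{\Big(\tilde f(t)\,\omega,\ \int_0^t\sqrt{1-\tilde f'(s)^2}\,ds\Big):\ t\in[-c,c],\ \omega\in S^{n-1}\Big\},$$ where $c>0$ and $\tilde f=f/|f'(c)|$ for smooth functions $f,h:\mathbb R\to\mathbb R$ such that $h\le 0$ is even, its support is contained in $\{t:\ 0<|t|<c,\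 |t|\ge \tfrac{\pi}{2}-\varepsilon\}$, and $$f''+f=h,\qquad f(0)=1,\quad f'(0)=0,\quad f>0\ \text{on}\ (-c,c),\quad f(c)=0;$$ furthermore $\tilde f'(c)=-1$ and $|\tilde f'|\le 1$ on $[-c,c]$. -/

import Mathlib

open scoped Manifold ContDiff

noncomputable section

/-- `ℝᵐ` with its Euclidean inner product. -/
abbrev EucSp (m : ℕ) : Type := EuclideanSpace ℝ (Fin m)

/-- The unit sphere `Sⁿ ⊆ ℝⁿ⁺¹` with its standard smooth structure. -/
abbrev UnitSph (n : ℕ) : Type := Metric.sphere (0 : EucSp (n + 1)) 1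

/-- A smooth (`C^∞`) Riemannian metric on the `n`-manifold `M`. -/
abbrev SmoothRiemMetric (n : ℕ) (M : Type*) [TopologicalSpace M] [ChartedSpace (EucSp n) M]
    [IsManifold (𝓡 n) ∞ M] : Type _ :=
  Bundle.ContMDiffRiemannianMetric (𝓡 n) ∞ (EucSp n) (fun x : M => TangentSpace (𝓡 n) x)

/-! Curvature of a metric `G = (g_{ij})` given in coordinates on (an open subset of) `ℝⁿ`. -/

/-- The partial derivative `∂ᵢ φ (x)`. -/
def partialD {n : ℕ} (i : Fin n) (φ : EucSp n → ℝ) (x : EucSp n) : ℝ :=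
  fderiv ℝ φ x (EuclideanSpace.single i 1)

/-- Christoffel symbols of the first kind,
`Γ_{ij,l} = ⟨∇_{∂ᵢ} ∂ⱼ, ∂ₗ⟩ = (∂ᵢ g_{jl} + ∂ⱼ g_{il} - ∂ₗ g_{ij}) / 2`. -/
def christoffelFirst {n : ℕ} (G : EucSp n → Matrix (Fin n) (Fin n) ℝ) (i j l : Fin n)
    (x : EucSp n) : ℝ :=
  (partialD i (fun y => G y j l) x + partialD j (fun y => G y i l) x
    - partialD l (fun y => G y i j) x) / 2

/-- The components `⟨R(∂ᵢ, ∂ⱼ) ∂ₖ, ∂ₗ⟩` of the Riemann curvature tensor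
`R(X, Y) Z = ∇_X ∇_Y Z - ∇_Y ∇_X Z - ∇_{[X, Y]} Z` of the Levi-Civita connection:
`∂ᵢ Γ_{jk,l} - ∂ⱼ Γ_{ik,l} - g^{pq} Γ_{jk,p} Γ_{il,q} + g^{pq} Γ_{ik,p} Γ_{jl,q}`. -/
def curvatureCoeff {n : ℕ} (G : EucSp n → Matrix (Fin n) (Fin n) ℝ) (i j k l : Fin n)
    (x : EucSp n) : ℝ :=
  partialD i (christoffelFirst G j k l) x - partialD j (christoffelFirst G i k l) x
    - ∑ p, ∑ q, (G x)⁻¹ p q * christoffelFirst G j k p x * christoffelFirst G i l q x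
    + ∑ p, ∑ q, (G x)⁻¹ p q * christoffelFirst G i k p x * christoffelFirst G j l q x

/-- The inner product `∑ g_{ij} uⁱ vʲ` at `x`. -/
def coordInner {n : ℕ} (G : EucSp n → Matrix (Fin n) (Fin n) ℝ) (x u v : EucSp n) : ℝ :=
  ∑ i, ∑ j, G x i j * u i * v j

/-- The sectional curvature `⟨R(u, v) v, u⟩ / (|u|² |v|² - ⟨u, v⟩²)` at `x` of the plane spanned by
`u = ∑ uⁱ ∂ᵢ` and `v = ∑ vʲ ∂ⱼ` (meaningful if `u`, `v` are linearly independent). -/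
def coordSectionalCurvature {n : ℕ} (G : EucSp n → Matrix (Fin n) (Fin n) ℝ)
    (x u v : EucSp n) : ℝ :=
  (∑ i, ∑ j, ∑ k, ∑ l, curvatureCoeff G i j k l x * u i * v j * v k * u l) /
    (coordInner G x u u * coordInner G x v v - coordInner G x u v ^ 2)

section Manifold

variable {n : ℕ} {M : Type*} [TopologicalSpace M] [ChartedSpace (EucSp n) M]
  [IsManifold (𝓡 n) ∞ M]

/-- The components `g_{ij} = g(∂ᵢ, ∂ⱼ)` of the metric `g` in the chart `e`, where
`∂ᵢ = d(e⁻¹)(eᵢ)`, as functions of the coordinates `x ∈ e.target`. -/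
def metricInChart (g : SmoothRiemMetric n M) (e : OpenPartialHomeomorph M (EucSp n))
    (x : EucSp n) : Matrix (Fin n) (Fin n) ℝ :=
  Matrix.of fun i j =>
    g.inner (e.symm x)
      (mfderiv (𝓡 n) (𝓡 n) e.symm x (EuclideanSpace.single i (1 : ℝ) : EucSp n))
      (mfderiv (𝓡 n) (𝓡 n) e.symm x (EuclideanSpace.single j (1 : ℝ) : EucSp n))

/-- `K(g) ≥ κ`: every sectional curvature of `g` is at least `κ`, computed in any smooth chart. -/
def SectionalCurvatureGE (g : SmoothRiemMetric n M) (κ : ℝ) : Prop :=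
  ∀ e ∈ IsManifold.maximalAtlas (𝓡 n) ∞ M, ∀ x ∈ e.target, ∀ u v : EucSp n,
    LinearIndependent ℝ ![u, v] → κ ≤ coordSectionalCurvature (metricInChart g e) x u v

/-- `F ∈ IE((M, g), ℝᵐ)`: `F` is smooth, injective, and `g` is the metric induced by `F`. -/
structure IsSmoothIsometricEmbedding {m : ℕ} (g : SmoothRiemMetric n M) (F : M → EucSp m) :
    Prop where
  smooth : ContMDiff (𝓡 n) 𝓘(ℝ, EucSp m) ∞ F
  injective : Function.Injective F
  isometric : ∀ (p : M) (u v : TangentSpace (𝓡 n) p),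
    g.inner p u v = inner ℝ (mvfderiv (𝓡 n) F p u) (mvfderiv (𝓡 n) F p v)

end Manifold

/-- `Diam_F(M) = sup_{x, y ∈ M} |F x - F y|` (a genuine supremum if `F` has bounded image). -/
def diamOfEmbedding {M : Type*} {m : ℕ} (F : M → EucSp m) : ℝ :=
  Metric.diam (Set.range F)

/-! Rotational symmetry about the last coordinate axis of `ℝⁿ⁺¹`. -/

/-- The isometry of `Sⁿ` induced by a linear isometry of `ℝⁿ⁺¹`. -/
def sphMap {n : ℕ} (A : EucSp (n + 1) ≃ₗᵢ[ℝ] EucSp (n + 1)) (p : UnitSph n) : UnitSph n :=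
  ⟨A p, by simp⟩

/-- `A` fixes the last coordinate axis pointwise, so `A` belongs to the `O(n)` acting on the first
`n` coordinates. -/
def FixesAxis {n : ℕ} (A : EucSp (n + 1) ≃ₗᵢ[ℝ] EucSp (n + 1)) : Prop :=
  A (EuclideanSpace.single (Fin.last n) 1) = EuclideanSpace.single (Fin.last n) 1

/-- The metric `g` on `Sⁿ` is invariant under the `O(n)` fixing the axis. -/
def IsRotationallySymmetric {n : ℕ} (g : SmoothRiemMetric n (UnitSph n)) : Prop :=
  ∀ A : EucSp (n + 1) ≃ₗᵢ[ℝ] EucSp (n + 1), FixesAxis A →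
    ∀ (p : UnitSph n) (u v : TangentSpace (𝓡 n) p),
      g.inner (sphMap A p) (mfderiv (𝓡 n) (𝓡 n) (sphMap A) p u)
        (mfderiv (𝓡 n) (𝓡 n) (sphMap A) p v) = g.inner p u v

/-- The map `F : Sⁿ → ℝⁿ⁺¹` commutes with the rotations about the axis. -/
def IsRotationallyEquivariant {n : ℕ} (F : UnitSph n → EucSp (n + 1)) : Prop :=
  ∀ A : EucSp (n + 1) ≃ₗᵢ[ℝ] EucSp (n + 1), FixesAxis A →
    ∀ p : UnitSph n, F (sphMap A p) = A (F p)

/-- The hypersurface of revolution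
`{(r(t) ω, ∫₀ᵗ √(1 - r'(s)²) ds) : t ∈ [-c, c], ω ∈ Sⁿ⁻¹}` in `ℝⁿ⁺¹`; away from the axis its
induced metric is `dt² + r(t)² dθ²`. -/
def hypersurfaceOfRevolution (n : ℕ) (c : ℝ) (r : ℝ → ℝ) : Set (EucSp (n + 1)) :=
  {y | ∃ t ∈ Set.Icc (-c) c,
    (∑ i : Fin n, y i.castSucc ^ 2 = r t ^ 2) ∧
    y (Fin.last n) = ∫ s in (0 : ℝ)..t, √(1 - deriv r s ^ 2)}

/-- `f` solves `f'' + f = h`, `f(0) = 1`, `f'(0) = 0`, and `c` is its first positive zero, where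
`h ≤ 0` is a smooth even cutoff function that vanishes near `0`, near `±c` and, except within
`ε` of the ends `±π/2`, on all of `[-π/2, π/2]`. -/
structure IsCutoffProfile (ε c : ℝ) (h f : ℝ → ℝ) : Prop where
  c_pos : 0 < c
  h_smooth : ContDiff ℝ ∞ h
  h_nonpos : ∀ t, h t ≤ 0
  h_even : ∀ t, h (-t) = h t
  h_support : tsupport h ⊆ {t | 0 < |t| ∧ Real.pi / 2 - ε ≤ |t| ∧ |t| < c}
  f_smooth : ContDiff ℝ ∞ f
  ode : ∀ t, deriv (deriv f) t + f t = h t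
  f_zero : f 0 = 1
  deriv_f_zero : deriv f 0 = 0
  f_pos : ∀ t ∈ Set.Ioo (-c) c, 0 < f t
  f_end : f c = 0

/-- The profile rescaled to have slope of absolute value `1` at the end `c`. -/
def rescaledProfile (c : ℝ) (f : ℝ → ℝ) (t : ℝ) : ℝ := f t / |deriv f c|

end

/-! Start from the profile `cos t` on `[-π/2, π/2]` and add a very concentrated negative force `h`
just before each end. The solution of `f'' + f = h` then turns sharply and reaches its zero `c` with
a large slope `A`. The profile `r = f / A` is very flat on most of the interval, so its hypersurface
of revolution is a thin spindle of length close to `π`. It still satisfies `r'' + r = h / A ≤ 0`,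
and beyond the support of `h` it equals `sin (c - t)`, so the spindle is closed by unit round caps.

The surface is convex, so it is parametrized over the sphere by the inverse of its Gauss map, `p ↦
a(z) p + b(z) e` with `z` the last coordinate of `p`. The unit normal is then `p` itself, and no
separate smoothness argument at the poles is needed, because `a` and `b` are constant on the caps.
The principal radii are `a = r / √(1 - r'²)` along parallels and `l = a + b' (1 - z²) = √(1 - r'²) /
(-r'')` along the meridian. By the Gauss equation `K ≥ 1` follows from `a ≤ 1` and `a l ≤ 1`. The
first is `r² + r'² ≤ 1`, the second is `r ≤ -r''`, and both come from `r'' + r ≤ 0`.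

The main lemmas are `sum_curvatureCoeff_eq` (Gauss equation), `sectionalCurvatureGE_revMetric`
(curvature of an inverse Gauss map), `exists_oscSol_steep` (the profile) and
`IsRoundEndedProfile.isGaussProfile` (passage from `r` to `a`, `b`). -/

noncomputable section

/-! ### The Riemannian metric induced by an immersion. -/

/-- The symmetric bilinear form `⟨D u, D v⟩` on `V` induced by a linear map `D`. -/
def pullbackInner {m : ℕ} {V : Type*} [AddCommGroup V] [Module ℝ V] [TopologicalSpace V]
    [IsTopologicalAddGroup V] [ContinuousSMul ℝ V]
    (D : V →L[ℝ] EucSp m) : V →L[ℝ] V →L[ℝ] ℝ :=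
  (ContinuousLinearMap.precomp ℝ D).comp ((innerSL ℝ).comp D)

lemma pullbackInner_apply {m : ℕ} {V : Type*} [AddCommGroup V] [Module ℝ V] [TopologicalSpace V]
    [IsTopologicalAddGroup V] [ContinuousSMul ℝ V] (D : V →L[ℝ] EucSp m) (u v : V) :
    pullbackInner D u v = inner ℝ (D u) (D v) := rfl

lemma contDiff_pullbackInner {n m : ℕ} :
    ContDiff ℝ ∞ (pullbackInner : (EucSp n →L[ℝ] EucSp m) → _) := by
  have h : (pullbackInner : (EucSp n →L[ℝ] EucSp m) → _) = fun D =>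
      ((ContinuousLinearMap.compL ℝ (EucSp n) (EucSp m) ℝ).flip D).comp ((innerSL ℝ).comp D) := by
    ext D u v; simp [pullbackInner]
  rw [h]
  fun_prop

section
variable {n m : ℕ} {M : Type*} [TopologicalSpace M] [ChartedSpace (EucSp n) M]
  [IsManifold (𝓡 n) ∞ M]

/-- The Riemannian metric induced by a smooth immersion. -/
def inducedMetric (F : M → EucSp m) (hF : ContMDiff (𝓡 n) 𝓘(ℝ, EucSp m) ∞ F)
    (hinj : ∀ p, Function.Injective (mvfderiv (𝓡 n) F p)) : SmoothRiemMetric n M where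
  inner p := pullbackInner (mvfderiv (𝓡 n) F p)
  symm p v w := by simp only [pullbackInner_apply]; exact real_inner_comm _ _
  pos p v hv := by
    rw [pullbackInner_apply]
    refine real_inner_self_pos.mpr fun h => hv (hinj p ?_)
    rw [h]; exact (map_zero _).symm
  isVonNBounded p := by
    let D : EucSp n →L[ℝ] EucSp m := mvfderiv (𝓡 n) F p
    have hD : Function.Injective D := hinj p
    -- An injective linear map in finite dimension is bounded below, so the unit ball of the
    -- pulled-back form is bounded.
    obtain ⟨K, hK, h⟩ := LinearMap.exists_antilipschitzWith D.toLinearMap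
      (LinearMap.ker_eq_bot.mpr hD)
    refine (NormedSpace.isVonNBounded_iff (E := EucSp n) ℝ).mpr ?_
    refine (Metric.isBounded_ball (x := (0 : EucSp n)) (r := K)).subset fun v hv => ?_
    have h1 : inner ℝ (D v) (D v) < (1 : ℝ) := hv
    rw [real_inner_self_eq_norm_sq] at h1
    have h2 := ZeroHomClass.bound_of_antilipschitz D h v
    have h3 : ‖D v‖ < 1 := by nlinarith [norm_nonneg (D v)]
    have h4 : (0 : ℝ) < K := by exact_mod_cast hK
    rw [mem_ball_zero_iff]
    nlinarith
  contMDiff x₀ := by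
    rw [contMDiffAt_hom_bundle]
    refine ⟨contMDiffAt_id, ?_⟩
    -- In a trivialization the metric is the smooth map `pullbackInner` applied to the coordinate
    -- expression of `dF`, which is smooth.
    have h1 := (hF x₀).mfderiv_const (m := ∞) (by simp)
    have h2 := contDiff_pullbackInner.contMDiff.contMDiffAt.comp x₀ h1
    refine h2.congr_of_eventuallyEq ?_
    have A : ∀ᶠ y in nhds x₀, y ∈ (trivializationAt (EucSp n) (TangentSpace (𝓡 n)) x₀).baseSet :=
      (trivializationAt (EucSp n) (TangentSpace (𝓡 n)) x₀).open_baseSet.mem_nhds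
        (FiberBundle.mem_baseSet_trivializationAt' x₀)
    filter_upwards [A] with y hy
    ext u v
    refine (inCoordinates_apply_eq₂ (E₁ := TangentSpace (𝓡 n)) (E₂ := TangentSpace (𝓡 n))
      (E₃ := Bundle.Trivial M ℝ)
      hy hy (Set.mem_univ _)).trans ?_
    simp only [Bundle.Trivial.fiberBundle_trivializationAt', Bundle.Trivial.linearMapAt_trivialization,
        LinearMap.id_coe, id_eq, pullbackInner_apply]
    have h3 : ∀ w : EucSp n, inTangentCoordinates (𝓡 n) 𝓘(ℝ, EucSp m) id F
      (fun x => mfderiv (𝓡 n) 𝓘(ℝ, EucSp m) F x) x₀ y w = mvfderiv (𝓡 n) F y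
        ((trivializationAt (EucSp n) (TangentSpace (𝓡 n)) x₀).symm y w) := by
      intro w
      simp [inTangentCoordinates, mvfderiv, ContinuousLinearMap.inCoordinates]
      rw [← Bundle.Trivialization.symmL_apply (R := ℝ) _ hy]
      rfl
    simp only [Function.comp_apply, pullbackInner_apply, h3]

end
end

/-! ### The Gauss equation for a hypersurface patch in coordinates. -/

noncomputable section

lemma map_eq_sum_single {n : ℕ} {E : Type*} [NormedAddCommGroup E] [NormedSpace ℝ E]
    (L : EucSp n →L[ℝ] E) (u : EucSp n) :
    L u = ∑ i, u i • L (EuclideanSpace.single i 1) := by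
  conv_lhs => rw [← (EuclideanSpace.basisFun (Fin n) ℝ).sum_repr u]
  simp [map_sum]

lemma inner_map_map_eq_sum {n m : ℕ} (L K : EucSp n →L[ℝ] EucSp m) (u v : EucSp n) :
    inner ℝ (L u) (K v) = ∑ i, ∑ j, u i * v j *
      inner ℝ (L (EuclideanSpace.single i 1)) (K (EuclideanSpace.single j 1)) := by
  rw [map_eq_sum_single L u, map_eq_sum_single K v, sum_inner]
  refine Finset.sum_congr rfl fun i _ => ?_
  rw [inner_sum]
  refine Finset.sum_congr rfl fun j _ => ?_
  rw [real_inner_smul_left, real_inner_smul_right, mul_assoc]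

/-- The inner product of `ℝⁿ⁺¹` expressed through a basis `D eᵢ` of a hyperplane, with Gram matrix
`G`, and a unit normal `ν`. -/
lemma inner_eq_sum_gram_inv {n : ℕ} (D : EucSp n →L[ℝ] EucSp (n + 1)) (hD : Function.Injective D)
    (ν : EucSp (n + 1)) (hν : ‖ν‖ = 1) (hDν : ∀ u, inner ℝ (D u) ν = 0)
    (G : Matrix (Fin n) (Fin n) ℝ)
    (hG : ∀ i j, G i j = inner ℝ (D (EuclideanSpace.single i 1)) (D (EuclideanSpace.single j 1)))
    (X Y : EucSp (n + 1)) :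
    ∑ p, ∑ q, G⁻¹ p q * inner ℝ X (D (EuclideanSpace.single p 1)) *
      inner ℝ Y (D (EuclideanSpace.single q 1)) =
    inner ℝ X Y - inner ℝ X ν * inner ℝ Y ν := by
  have hνν : inner ℝ ν ν = (1 : ℝ) := by rw [real_inner_self_eq_norm_sq, hν]; norm_num
  have hνD : ∀ u, inner ℝ ν (D u) = 0 := fun u => by rw [real_inner_comm]; exact hDν u
  let L : (EucSp n × ℝ) →ₗ[ℝ] EucSp (n + 1) :=
    D.toLinearMap.coprod (LinearMap.toSpanSingleton ℝ _ ν)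
  have hL : ∀ z, L z = D z.1 + z.2 • ν := fun z => by simp [L]
  have hinj : Function.Injective L := by
    rw [← LinearMap.ker_eq_bot, LinearMap.ker_eq_bot']
    rintro ⟨α, ξ⟩ h
    rw [hL] at h
    simp only at h
    have h1 : ξ = 0 := by
      have := congrArg (fun w => inner ℝ w ν) h
      simpa only [inner_add_left, hDν, real_inner_smul_left, hνν, inner_zero_left, zero_add,
        mul_one] using this
    subst h1
    have h2 : D α = D 0 := by simpa using h
    rw [hD h2]; rfl
  -- By dimension, `D` and `ν` together span the whole space. Hence `X = D α + ξ ν`, and `G⁻¹`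
  -- recovers `α` from the products of `X` with the `D eᵢ`.
  have hsurj : Function.Surjective L :=
    (LinearMap.injective_iff_surjective_of_finrank_eq_finrank (by simp)).mp hinj
  have hGdet : IsUnit G.det := by
    rw [isUnit_iff_ne_zero, Ne, ← Matrix.exists_mulVec_eq_zero_iff]
    rintro ⟨w, hw, h⟩
    apply hw
    have h1 : inner ℝ (D (WithLp.toLp 2 w)) (D (WithLp.toLp 2 w)) = (0 : ℝ) := by
      have : inner ℝ (D (WithLp.toLp 2 w)) (D (WithLp.toLp 2 w)) = w ⬝ᵥ (G.mulVec w) := by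
        rw [inner_map_map_eq_sum]
        simp only [dotProduct, Matrix.mulVec, hG, Finset.mul_sum]
        refine Finset.sum_congr rfl fun i _ => Finset.sum_congr rfl fun j _ => ?_
        ring
      rw [this, h]; simp
    have h2 : D (WithLp.toLp 2 w) = D 0 := by simpa using h1
    have := congrArg WithLp.ofLp (hD h2)
    simpa using this
  obtain ⟨⟨α, ξ⟩, rfl⟩ := hsurj X
  rw [hL]
  have hX : ∀ p, inner ℝ (D α + ξ • ν) (D (EuclideanSpace.single p 1)) =
      ∑ r, α r * G r p := fun p => by
    rw [inner_add_left, inner_smul_left, hνD, map_eq_sum_single D α, sum_inner]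
    simp [inner_smul_left, hG]
  have hmul : ∀ r q, ∑ p, G r p * G⁻¹ p q = if r = q then 1 else 0 := fun r q => by
    rw [← Matrix.mul_apply, Matrix.mul_nonsing_inv _ hGdet, Matrix.one_apply]
  have hα : ∀ q, ∑ p, (∑ r, α r * G r p) * G⁻¹ p q = α q := fun q => by
    simp_rw [Finset.sum_mul, mul_assoc]
    rw [Finset.sum_comm]
    simp_rw [← Finset.mul_sum, hmul]
    simp
  simp only [hX]
  rw [Finset.sum_comm]
  have : ∀ q, ∑ p, G⁻¹ p q * (∑ r, α r * G r p) * inner ℝ Y (D (EuclideanSpace.single q 1)) =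
      α q * inner ℝ Y (D (EuclideanSpace.single q 1)) := fun q => by
    rw [← Finset.sum_mul]
    congr 1
    rw [← hα q]
    exact Finset.sum_congr rfl fun p _ => mul_comm _ _
  simp only [this]
  simp only [inner_add_left, inner_smul_left, hDν, hνν]
  rw [map_eq_sum_single D α, sum_inner]
  simp only [real_inner_smul_left, real_inner_comm (D _) Y, real_inner_comm ν Y]
  ring

lemma partialD_congr {n : ℕ} {U : Set (EucSp n)} (hU : IsOpen U) {φ ψ : EucSp n → ℝ}
    (h : ∀ y ∈ U, φ y = ψ y) {x : EucSp n} (hx : x ∈ U) (i : Fin n) :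
    partialD i φ x = partialD i ψ x := by
  unfold partialD
  rw [Filter.EventuallyEq.fderiv_eq (Filter.eventually_of_mem (hU.mem_nhds hx) h)]

lemma partialD_inner {n m : ℕ} {X Y : EucSp n → EucSp m} {x : EucSp n}
    (hX : DifferentiableAt ℝ X x) (hY : DifferentiableAt ℝ Y x) (i : Fin n) :
    partialD i (fun y => inner ℝ (X y) (Y y)) x =
      inner ℝ (X x) (fderiv ℝ Y x (EuclideanSpace.single i 1)) +
      inner ℝ (fderiv ℝ X x (EuclideanSpace.single i 1)) (Y x) := by
  unfold partialD
  rw [fderiv_inner_apply ℝ hX hY]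

section
variable {n m : ℕ} {U : Set (EucSp n)}

/-- The vector-valued partial derivative `∂ᵢ X`. -/
def partialV (i : Fin n) (X : EucSp n → EucSp m) (y : EucSp n) : EucSp m :=
  fderiv ℝ X y (EuclideanSpace.single i 1)

lemma contDiffOn_partialV (hU : IsOpen U) {X : EucSp n → EucSp m} (hX : ContDiffOn ℝ ∞ X U)
    (i : Fin n) : ContDiffOn ℝ ∞ (partialV i X) U :=
  (hX.fderiv_of_isOpen hU (by simp)).clm_apply contDiffOn_const

lemma partialV_comm (hU : IsOpen U) {X : EucSp n → EucSp m} (hX : ContDiffOn ℝ ∞ X U)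
    (i j : Fin n) {x : EucSp n} (hx : x ∈ U) :
    partialV i (partialV j X) x = partialV j (partialV i X) x := by
  have h1 : DifferentiableAt ℝ (fderiv ℝ X) x :=
    ((hX.fderiv_of_isOpen hU (m := ∞) (by simp)).differentiableOn (by simp)).differentiableAt
      (hU.mem_nhds hx)
  have h2 : IsSymmSndFDerivAt ℝ X x :=
    (hX.contDiffAt (hU.mem_nhds hx)).isSymmSndFDerivAt (by
      rw [minSmoothness_of_isRCLikeNormedField]; exact WithTop.coe_le_coe.mpr le_top)
  have h3 : ∀ a b : Fin n, partialV a (partialV b X) x =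
      fderiv ℝ (fderiv ℝ X) x (EuclideanSpace.single a 1) (EuclideanSpace.single b 1) := by
    intro a b
    unfold partialV
    rw [fderiv_clm_apply h1 (differentiableAt_const _)]
    simp
  rw [h3, h3]
  exact h2 _ _

lemma partialD_inner_of_contDiffOn (hU : IsOpen U) {X Y : EucSp n → EucSp m}
    (hX : ContDiffOn ℝ ∞ X U) (hY : ContDiffOn ℝ ∞ Y U) {x : EucSp n} (hx : x ∈ U) (i : Fin n) :
    partialD i (fun y => inner ℝ (X y) (Y y)) x =
      inner ℝ (X x) (partialV i Y x) + inner ℝ (partialV i X x) (Y x) :=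
  partialD_inner ((hX.differentiableOn (by simp)).differentiableAt (hU.mem_nhds hx))
    ((hY.differentiableOn (by simp)).differentiableAt (hU.mem_nhds hx)) i

/-- Christoffel symbols of an induced metric. -/
lemma christoffelFirst_eq_inner (hU : IsOpen U) {Φ : EucSp n → EucSp m} (hΦ : ContDiffOn ℝ ∞ Φ U)
    {G : EucSp n → Matrix (Fin n) (Fin n) ℝ}
    (hG : ∀ y ∈ U, ∀ i j, G y i j = inner ℝ (partialV i Φ y) (partialV j Φ y))
    (i j l : Fin n) {x : EucSp n} (hx : x ∈ U) :
    christoffelFirst G i j l x = inner ℝ (partialV i (partialV j Φ) x) (partialV l Φ x) := by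
  have key : ∀ a b c : Fin n, partialD a (fun y => G y b c) x =
      inner ℝ (partialV b Φ x) (partialV a (partialV c Φ) x) +
      inner ℝ (partialV a (partialV b Φ) x) (partialV c Φ x) := fun a b c => by
    rw [partialD_congr hU (fun y hy => hG y hy b c) hx]
    exact partialD_inner_of_contDiffOn hU (contDiffOn_partialV hU hΦ b)
      (contDiffOn_partialV hU hΦ c) hx a
  unfold christoffelFirst
  -- Once mixed partials are identified, four of the six product-rule terms cancel and the other two
  -- coincide.
  rw [key, key, key, partialV_comm hU hΦ j i hx, partialV_comm hU hΦ l i hx,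
    partialV_comm hU hΦ l j hx, real_inner_comm (partialV j Φ x) (partialV i (partialV l Φ) x)]
  ring

/-- The Gauss equation in coordinates. -/
lemma curvatureCoeff_eq (hU : IsOpen U) {Φ N : EucSp n → EucSp (n + 1)}
    (hΦ : ContDiffOn ℝ ∞ Φ U) (hN1 : ∀ y ∈ U, ‖N y‖ = 1)
    (hΦN : ∀ y ∈ U, ∀ u, inner ℝ (fderiv ℝ Φ y u) (N y) = 0)
    (hinj : ∀ y ∈ U, Function.Injective (fderiv ℝ Φ y))
    {G : EucSp n → Matrix (Fin n) (Fin n) ℝ}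
    (hG : ∀ y ∈ U, ∀ i j, G y i j = inner ℝ (partialV i Φ y) (partialV j Φ y))
    (i j k l : Fin n) {x : EucSp n} (hx : x ∈ U) :
    curvatureCoeff G i j k l x =
      inner ℝ (partialV j (partialV k Φ) x) (N x) * inner ℝ (partialV i (partialV l Φ) x) (N x) -
      inner ℝ (partialV i (partialV k Φ) x) (N x) * inner ℝ (partialV j (partialV l Φ) x) (N x)
      := by
  have hP := contDiffOn_partialV hU hΦ
  have hQ := fun a b => contDiffOn_partialV hU (hP b) a
  have key : ∀ a b c d : Fin n, partialD a (christoffelFirst G b c d) x =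
      inner ℝ (partialV b (partialV c Φ) x) (partialV a (partialV d Φ) x) +
      inner ℝ (partialV a (partialV b (partialV c Φ)) x) (partialV d Φ x) := fun a b c d => by
    rw [partialD_congr hU (fun y hy => christoffelFirst_eq_inner hU hΦ hG b c d hy) hx]
    exact partialD_inner_of_contDiffOn hU (hQ b c) (hP d) hx a
  -- The quadratic Christoffel terms are the tangential parts of products of second derivatives.
  -- They cancel the corresponding terms of `key` up to the normal parts; the third derivatives
  -- cancel by symmetry.
  have gram := inner_eq_sum_gram_inv (fderiv ℝ Φ x) (hinj x hx) (N x) (hN1 x hx) (hΦN x hx) (G x)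
    (hG x hx)
  unfold curvatureCoeff
  simp only [christoffelFirst_eq_inner hU hΦ hG _ _ _ hx]
  rw [key, key, partialV_comm hU (hP k) j i hx]
  unfold partialV at gram ⊢
  rw [gram, gram]
  ring

/-- The second fundamental form through the derivative of the normal. -/
lemma inner_partialV_partialV_normal (hU : IsOpen U) {Φ N : EucSp n → EucSp m}
    (hΦ : ContDiffOn ℝ ∞ Φ U) (hN : ContDiffOn ℝ ∞ N U)
    (hΦN : ∀ y ∈ U, ∀ u, inner ℝ (fderiv ℝ Φ y u) (N y) = 0)
    (i j : Fin n) {x : EucSp n} (hx : x ∈ U) :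
    inner ℝ (partialV i (partialV j Φ) x) (N x) = - inner ℝ (partialV j Φ x) (partialV i N x) := by
  have h := partialD_inner_of_contDiffOn hU (contDiffOn_partialV hU hΦ j) hN hx i
  rw [partialD_congr hU (φ := fun y => inner ℝ (partialV j Φ y) (N y)) (ψ := fun _ => 0)
    (fun y hy => hΦN y hy _) hx] at h
  simp only [partialD, fderiv_fun_const] at h
  simp at h
  linarith

/-- Each of the two products separates into a pair of independent double sums, which are the values
of the form `B` on `u` and `v`. -/
lemma sum_four_mul (B : Fin n → Fin n → ℝ) (u v : Fin n → ℝ) :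
    ∑ i, ∑ j, ∑ k, ∑ l, (B j k * B i l - B i k * B j l) * u i * v j * v k * u l =
      (∑ i, ∑ j, B i j * u i * u j) * (∑ i, ∑ j, B i j * v i * v j) -
      (∑ i, ∑ j, B i j * u i * v j) * (∑ i, ∑ j, B i j * v i * u j) := by
  have h1 : ∀ f g : Fin n → Fin n → ℝ, ∑ i, ∑ j, ∑ k, ∑ l, g i l * f j k =
      (∑ i, ∑ l, g i l) * ∑ j, ∑ k, f j k := fun f g => by
    simp_rw [← Finset.sum_mul, ← Finset.mul_sum]
    rw [Finset.sum_mul]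
  have h2 : ∀ f g : Fin n → Fin n → ℝ, ∑ i, ∑ j, ∑ k, ∑ l, g i k * f j l =
      (∑ i, ∑ k, g i k) * ∑ j, ∑ l, f j l := fun f g => by
    simp_rw [← Finset.mul_sum, ← Finset.sum_mul]
    rw [Finset.sum_mul_sum]
  rw [← h1 (fun j k => B j k * v j * v k), ← h2 (fun j l => B j l * v j * u l)]
  simp only [← Finset.sum_sub_distrib]
  refine Finset.sum_congr rfl fun i _ => Finset.sum_congr rfl fun j _ =>
    Finset.sum_congr rfl fun k _ => Finset.sum_congr rfl fun l _ => ?_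
  ring

/-- The Gauss equation for the numerator of the sectional curvature. -/
lemma sum_curvatureCoeff_eq (hU : IsOpen U) {Φ N : EucSp n → EucSp (n + 1)}
    (hΦ : ContDiffOn ℝ ∞ Φ U) (hN : ContDiffOn ℝ ∞ N U) (hN1 : ∀ y ∈ U, ‖N y‖ = 1)
    (hΦN : ∀ y ∈ U, ∀ u, inner ℝ (fderiv ℝ Φ y u) (N y) = 0)
    (hinj : ∀ y ∈ U, Function.Injective (fderiv ℝ Φ y))
    {G : EucSp n → Matrix (Fin n) (Fin n) ℝ}
    (hG : ∀ y ∈ U, ∀ i j, G y i j = inner ℝ (partialV i Φ y) (partialV j Φ y))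
    {x : EucSp n} (hx : x ∈ U) (u v : EucSp n) :
    ∑ i, ∑ j, ∑ k, ∑ l, curvatureCoeff G i j k l x * u i * v j * v k * u l =
      inner ℝ (fderiv ℝ Φ x u) (fderiv ℝ N x u) * inner ℝ (fderiv ℝ Φ x v) (fderiv ℝ N x v) -
      inner ℝ (fderiv ℝ Φ x v) (fderiv ℝ N x u) * inner ℝ (fderiv ℝ Φ x u) (fderiv ℝ N x v)
      := by
  simp only [curvatureCoeff_eq hU hΦ hN1 hΦN hinj hG _ _ _ _ hx]
  rw [sum_four_mul (fun i j => inner ℝ (partialV i (partialV j Φ) x) (N x)) u v]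
  have key : ∀ a b : EucSp n, ∑ i, ∑ j, inner ℝ (partialV i (partialV j Φ) x) (N x) * a i * b j =
      - inner ℝ (fderiv ℝ Φ x b) (fderiv ℝ N x a) := fun a b => by
    simp only [inner_partialV_partialV_normal hU hΦ hN hΦN _ _ hx]
    rw [inner_map_map_eq_sum, Finset.sum_comm]
    simp only [partialV, ← Finset.sum_neg_distrib]
    refine Finset.sum_congr rfl fun i _ => Finset.sum_congr rfl fun j _ => ?_
    ring
  simp only [key]
  ring

/-- The induced inner product in coordinates. -/
lemma coordInner_eq {Φ : EucSp n → EucSp m} {G : EucSp n → Matrix (Fin n) (Fin n) ℝ}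
    {x : EucSp n} (hG : ∀ i j, G x i j = inner ℝ (partialV i Φ x) (partialV j Φ x))
    (u v : EucSp n) : coordInner G x u v = inner ℝ (fderiv ℝ Φ x u) (fderiv ℝ Φ x v) := by
  unfold coordInner
  rw [inner_map_map_eq_sum]
  simp only [hG, partialV]
  refine Finset.sum_congr rfl fun i _ => Finset.sum_congr rfl fun j _ => ?_
  ring
end
end

/-! ### From coordinates to manifolds: a curvature criterion for induced metrics. -/

noncomputable section

section
variable {n m : ℕ} {M : Type*} [TopologicalSpace M] [ChartedSpace (EucSp n) M]

lemma mfderiv_chart_symm_injective {e : OpenPartialHomeomorph M (EucSp n)}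
    (he : e ∈ IsManifold.maximalAtlas (𝓡 n) ∞ M) {x : EucSp n} (hx : x ∈ e.target) :
    Function.Injective (mfderiv (𝓡 n) (𝓡 n) e.symm x) := by
  have h : e.MDifferentiable (𝓡 n) (𝓡 n) :=
    ⟨(contMDiffOn_of_mem_maximalAtlas he).mdifferentiableOn (by simp),
      (contMDiffOn_symm_of_mem_maximalAtlas he).mdifferentiableOn (by simp)⟩
  exact h.symm.mfderiv_injective hx

lemma contDiffOn_comp_chart_symm {F : M → EucSp m} (hF : ContMDiff (𝓡 n) 𝓘(ℝ, EucSp m) ∞ F)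
    {e : OpenPartialHomeomorph M (EucSp n)} (he : e ∈ IsManifold.maximalAtlas (𝓡 n) ∞ M) :
    ContDiffOn ℝ ∞ (F ∘ e.symm) e.target :=
  (hF.comp_contMDiffOn (contMDiffOn_symm_of_mem_maximalAtlas he)).contDiffOn

lemma fderiv_comp_chart_symm {F : M → EucSp m} (hF : ContMDiff (𝓡 n) 𝓘(ℝ, EucSp m) ∞ F)
    {e : OpenPartialHomeomorph M (EucSp n)} (he : e ∈ IsManifold.maximalAtlas (𝓡 n) ∞ M)
    {x : EucSp n} (hx : x ∈ e.target) (u : EucSp n) :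
    fderiv ℝ (F ∘ e.symm) x u =
      mvfderiv (𝓡 n) F (e.symm x) (mfderiv (𝓡 n) (𝓡 n) e.symm x u) := by
  have h := mfderiv_comp_apply (I := 𝓡 n) (I' := 𝓡 n) (I'' := 𝓘(ℝ, EucSp m)) (g := F)
    (f := e.symm) x ((hF _).mdifferentiableAt (by simp))
    (((contMDiffOn_symm_of_mem_maximalAtlas he).contMDiffAt
      (e.open_target.mem_nhds hx)).mdifferentiableAt (by simp)) u
  rw [mfderiv_eq_fderiv] at h
  exact h

/-- A hypersurface of Euclidean space has sectional curvature at least `κ` if its second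
fundamental form is large enough with respect to its first one. -/
lemma sectionalCurvatureGE_inducedMetric [IsManifold (𝓡 n) ∞ M] (F ν : M → EucSp (n + 1))
    (hF : ContMDiff (𝓡 n) 𝓘(ℝ, EucSp (n + 1)) ∞ F) (hν : ContMDiff (𝓡 n) 𝓘(ℝ, EucSp (n + 1)) ∞ ν)
    (hinj : ∀ p, Function.Injective (mvfderiv (𝓡 n) F p)) (hν1 : ∀ p, ‖ν p‖ = 1)
    (hFν : ∀ p u, inner ℝ (mvfderiv (𝓡 n) F p u) (ν p) = 0) (κ : ℝ)
    (hκ : ∀ p (u v : TangentSpace (𝓡 n) p),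
      let Fu := mvfderiv (𝓡 n) F p u
      let Fv := mvfderiv (𝓡 n) F p v
      let νu := mvfderiv (𝓡 n) ν p u
      let νv := mvfderiv (𝓡 n) ν p v
      κ * (inner ℝ Fu Fu * inner ℝ Fv Fv - inner ℝ Fu Fv ^ 2) ≤
        inner ℝ Fu νu * inner ℝ Fv νv - inner ℝ Fv νu * inner ℝ Fu νv) :
    SectionalCurvatureGE (inducedMetric F hF hinj) κ := by
  intro e he x hx u v huv
  have hG : ∀ y ∈ e.target, ∀ i j, metricInChart (inducedMetric F hF hinj) e y i j =
      inner ℝ (partialV i (F ∘ e.symm) y) (partialV j (F ∘ e.symm) y) := fun y hy i j => by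
    unfold partialV
    rw [fderiv_comp_chart_symm hF he hy, fderiv_comp_chart_symm hF he hy]
    rfl
  have hinj' : ∀ y ∈ e.target, Function.Injective (fderiv ℝ (F ∘ e.symm) y) :=
    fun y hy a b hab => by
      rw [fderiv_comp_chart_symm hF he hy, fderiv_comp_chart_symm hF he hy] at hab
      exact mfderiv_chart_symm_injective he hy (hinj _ hab)
  have hnum := sum_curvatureCoeff_eq (N := ν ∘ e.symm) e.open_target
    (contDiffOn_comp_chart_symm hF he) (contDiffOn_comp_chart_symm hν he) (fun y _ => hν1 _)
    (fun y hy a => by rw [fderiv_comp_chart_symm hF he hy]; exact hFν _ _) hinj' hG hx u v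
  unfold coordSectionalCurvature
  rw [hnum, coordInner_eq (hG x hx), coordInner_eq (hG x hx), coordInner_eq (hG x hx)]
  have hpos : 0 < inner ℝ (fderiv ℝ (F ∘ e.symm) x u) (fderiv ℝ (F ∘ e.symm) x u) *
      inner ℝ (fderiv ℝ (F ∘ e.symm) x v) (fderiv ℝ (F ∘ e.symm) x v) -
      inner ℝ (fderiv ℝ (F ∘ e.symm) x u) (fderiv ℝ (F ∘ e.symm) x v) ^ 2 := by
    have hind : LinearIndependent ℝ ![fderiv ℝ (F ∘ e.symm) x u, fderiv ℝ (F ∘ e.symm) x v] := by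
      rw [LinearIndependent.pair_iff] at huv ⊢
      intro a b hab
      apply huv a b
      apply hinj' x hx
      rw [map_add, map_smul, map_smul, hab, map_zero]
    set X := fderiv ℝ (F ∘ e.symm) x u
    set Y := fderiv ℝ (F ∘ e.symm) x v
    have h1 := abs_real_inner_div_norm_mul_norm_eq_one_iff X Y
    have hX : X ≠ 0 := hind.ne_zero 0
    have hY : Y ≠ 0 := hind.ne_zero 1
    have hXn : 0 < ‖X‖ := norm_pos_iff.mpr hX
    have hYn : 0 < ‖Y‖ := norm_pos_iff.mpr hY
    -- Equality in Cauchy–Schwarz would make `Y` a multiple of `X`.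
    have h2 : |inner ℝ X Y| ≠ ‖X‖ * ‖Y‖ := fun h => by
      have h3 : |inner ℝ X Y / (‖X‖ * ‖Y‖)| = 1 := by
        rw [abs_div, abs_of_pos (mul_pos hXn hYn), h, div_self (mul_pos hXn hYn).ne']
      obtain ⟨-, r, -, hr⟩ := h1.mp h3
      have := LinearIndependent.pair_iff.mp hind r (-1) (by rw [hr]; simp)
      simp at this
    have h3 := lt_of_le_of_ne (abs_real_inner_le_norm X Y) h2
    rw [real_inner_self_eq_norm_sq, real_inner_self_eq_norm_sq, ← sq_abs (inner ℝ X Y)]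
    nlinarith [abs_nonneg (inner ℝ X Y)]
  rw [le_div_iff₀ hpos]
  have := hκ (e.symm x) (mfderiv (𝓡 n) (𝓡 n) e.symm x u) (mfderiv (𝓡 n) (𝓡 n) e.symm x v)
  simp only [← fderiv_comp_chart_symm hF he hx, ← fderiv_comp_chart_symm hν he hx] at this
  exact this
end
end

/-! ### Inverse Gauss maps of hypersurfaces of revolution and their curvature. -/

noncomputable section

/-- The last coordinate vector of `ℝⁿ⁺¹`. -/
abbrev axisVec (n : ℕ) : EucSp (n + 1) := EuclideanSpace.single (Fin.last n) 1

/-- The map `y ↦ a(z) y + b(z) e`, where `e` is the last coordinate vector and `z = ⟨y, e⟩`. -/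
def revMap {n : ℕ} (a b : ℝ → ℝ) (y : EucSp (n + 1)) : EucSp (n + 1) :=
  a (y (Fin.last n)) • y + b (y (Fin.last n)) • axisVec n

/-- Conditions on `a` and `b` under which `p ↦ a(z) p + b(z) e` is the inverse of the Gauss map of a
convex hypersurface of revolution whose sectional curvatures are at least one. -/
structure IsGaussProfile (a b : ℝ → ℝ) : Prop where
  smooth_a : ContDiff ℝ ∞ a
  smooth_b : ContDiff ℝ ∞ b
  deriv_a : ∀ z ∈ Set.Icc (-1 : ℝ) 1, deriv a z = - z * deriv b z
  a_pos : ∀ z ∈ Set.Icc (-1 : ℝ) 1, 0 < a z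
  a_le_one : ∀ z ∈ Set.Icc (-1 : ℝ) 1, a z ≤ 1
  meridian_pos : ∀ z ∈ Set.Icc (-1 : ℝ) 1, 0 < a z + deriv b z * (1 - z ^ 2)
  mul_le_one : ∀ z ∈ Set.Icc (-1 : ℝ) 1, a z * (a z + deriv b z * (1 - z ^ 2)) ≤ 1
  deriv_b_eq_zero : ∀ z, z ^ 2 = 1 → deriv b z = 0

section
variable {n : ℕ} {a b : ℝ → ℝ}

lemma inner_axisVec (y : EucSp (n + 1)) : inner ℝ y (axisVec n) = y (Fin.last n) := by
  simp [axisVec, EuclideanSpace.inner_single_right]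

lemma contDiff_revMap (ha : ContDiff ℝ ∞ a) (hb : ContDiff ℝ ∞ b) :
    ContDiff ℝ ∞ (revMap a b : EucSp (n + 1) → _) := by
  have h : ContDiff ℝ ∞ (fun y : EucSp (n + 1) => y (Fin.last n)) :=
    (EuclideanSpace.proj (𝕜 := ℝ) (Fin.last n)).contDiff
  exact ((ha.comp h).smul contDiff_id).add ((hb.comp h).smul contDiff_const)

lemma fderiv_revMap (ha : ContDiff ℝ ∞ a) (hb : ContDiff ℝ ∞ b) (y w : EucSp (n + 1)) :
    fderiv ℝ (revMap a b) y w = a (y (Fin.last n)) • w +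
      w (Fin.last n) • (deriv a (y (Fin.last n)) • y + deriv b (y (Fin.last n)) • axisVec n) := by
  have h : HasFDerivAt (fun y : EucSp (n + 1) => y (Fin.last n))
      (EuclideanSpace.proj (𝕜 := ℝ) (Fin.last n)) y :=
    (EuclideanSpace.proj (𝕜 := ℝ) (Fin.last n)).hasFDerivAt
  have h1 := ((ha.differentiable (by simp) _).hasDerivAt.comp_hasFDerivAt y h).smul
    (hasFDerivAt_id y)
  have h2 := ((hb.differentiable (by simp) _).hasDerivAt.comp_hasFDerivAt y h).smul
    (hasFDerivAt_const (axisVec n) y)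
  have h3 : HasFDerivAt (revMap a b) _ y := h1.add h2
  rw [h3.fderiv]
  simp [smul_smul, smul_add, add_assoc, mul_comm]

lemma last_mem_Icc {p : EucSp (n + 1)} (hp : ‖p‖ = 1) : p (Fin.last n) ∈ Set.Icc (-1 : ℝ) 1 := by
  have := PiLp.norm_apply_le p (Fin.last n)
  rw [hp, Real.norm_eq_abs] at this
  exact abs_le.mp this

/-- On the sphere, the differential of `revMap` is a combination of the identity and the projection
to the meridian direction. -/
lemma fderiv_revMap_of_norm_eq_one (h : IsGaussProfile a b) {p : EucSp (n + 1)} (hp : ‖p‖ = 1)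
    (w : EucSp (n + 1)) :
    fderiv ℝ (revMap a b) p w = a (p (Fin.last n)) • w +
      (deriv b (p (Fin.last n)) * w (Fin.last n)) • (axisVec n - p (Fin.last n) • p) := by
  rw [fderiv_revMap h.smooth_a h.smooth_b, h.deriv_a _ (last_mem_Icc hp)]
  module

/-- This makes `p` a normal vector at the image of `p`, so that `revMap` on the sphere inverts the
Gauss map. It rests on the relation `a' = -z b'`. -/
lemma inner_fderiv_revMap_self (h : IsGaussProfile a b) {p w : EucSp (n + 1)} (hp : ‖p‖ = 1)
    (hw : inner ℝ w p = 0) : inner ℝ (fderiv ℝ (revMap a b) p w) p = 0 := by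
  have hpp : inner ℝ p p = (1 : ℝ) := by rw [real_inner_self_eq_norm_sq, hp]; norm_num
  rw [fderiv_revMap_of_norm_eq_one h hp, inner_add_left, real_inner_smul_left,
    real_inner_smul_left, inner_sub_left, real_inner_smul_left, hw, hpp,
    real_inner_comm, inner_axisVec]
  ring

lemma inner_fderiv_revMap (h : IsGaussProfile a b) {p w : EucSp (n + 1)} (hp : ‖p‖ = 1)
    (hw : inner ℝ w p = 0) (v : EucSp (n + 1)) :
    inner ℝ (fderiv ℝ (revMap a b) p v) w = a (p (Fin.last n)) * inner ℝ v w +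
      deriv b (p (Fin.last n)) * v (Fin.last n) * w (Fin.last n) := by
  rw [fderiv_revMap_of_norm_eq_one h hp, inner_add_left, real_inner_smul_left,
    real_inner_smul_left, inner_sub_left, real_inner_smul_left, real_inner_comm w p, hw,
    real_inner_comm w (axisVec n), inner_axisVec]
  ring

/-- With `s = 1 - z²` and `l = a + b' s`, the coefficient of the last term is `(l² - a²) / s`,
written without the division so that it makes sense at the poles. -/
lemma inner_fderiv_revMap_fderiv_revMap (h : IsGaussProfile a b) {p v w : EucSp (n + 1)}
    (hp : ‖p‖ = 1) (hv : inner ℝ v p = 0) (hw : inner ℝ w p = 0) :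
    inner ℝ (fderiv ℝ (revMap a b) p v) (fderiv ℝ (revMap a b) p w) =
      a (p (Fin.last n)) ^ 2 * inner ℝ v w + deriv b (p (Fin.last n)) *
        (2 * a (p (Fin.last n)) + deriv b (p (Fin.last n)) * (1 - p (Fin.last n) ^ 2)) *
        (v (Fin.last n) * w (Fin.last n)) := by
  rw [inner_fderiv_revMap h hp (inner_fderiv_revMap_self h hp hw),
    real_inner_comm, inner_fderiv_revMap h hp hv, fderiv_revMap_of_norm_eq_one h hp w,
    real_inner_comm v w]
  simp only [PiLp.add_apply, PiLp.smul_apply, PiLp.sub_apply, smul_eq_mul,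
    PiLp.single_apply, if_true]
  ring

/-- The Gram determinant of three vectors is nonnegative. -/
lemma gram_three_nonneg {E : Type*} [NormedAddCommGroup E] [InnerProductSpace ℝ E] (u v e : E) :
    inner ℝ v e ^ 2 * inner ℝ u u + inner ℝ u e ^ 2 * inner ℝ v v -
      2 * inner ℝ u e * inner ℝ v e * inner ℝ u v ≤
    inner ℝ e e * (inner ℝ u u * inner ℝ v v - inner ℝ u v ^ 2) := by
  have h := (Matrix.posSemidef_gram ℝ ![u, v, e]).det_nonneg
  rw [Matrix.det_fin_three] at h
  simp only [Matrix.gram_apply, Matrix.cons_val_zero, Matrix.cons_val_one, Matrix.cons_val_two,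
    Matrix.head_cons, Matrix.tail_cons] at h
  simp only [real_inner_comm u v, real_inner_comm u e, real_inner_comm v e] at h ⊢
  linarith

/-- The comparison of first and second fundamental forms which expresses `K ≥ 1`. -/
lemma gauss_profile_inequality {A B s uu vv uv x y : ℝ} (hA : 0 < A) (hA1 : A ≤ 1) (hs : 0 ≤ s)
    (hl : A * (A + B * s) ≤ 1) (hl0 : 0 < A + B * s) (hB : s = 0 → B = 0)
    (hgram : y ^ 2 * uu + x ^ 2 * vv - 2 * x * y * uv ≤ s * (uu * vv - uv ^ 2))
    (hT : 0 ≤ y ^ 2 * uu + x ^ 2 * vv - 2 * x * y * uv) (hQ : 0 ≤ uu * vv - uv ^ 2) :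
    (A ^ 2 * uu + B * (2 * A + B * s) * (x * x)) * (A ^ 2 * vv + B * (2 * A + B * s) * (y * y)) -
      (A ^ 2 * uv + B * (2 * A + B * s) * (x * y)) ^ 2 ≤
    (A * uu + B * x * x) * (A * vv + B * y * y) - (A * uv + B * y * x) * (A * uv + B * x * y) := by
  set Q := uu * vv - uv ^ 2 with hQd
  set T := y ^ 2 * uu + x ^ 2 * vv - 2 * x * y * uv with hTd
  have e1 : (A ^ 2 * uu + B * (2 * A + B * s) * (x * x)) *
      (A ^ 2 * vv + B * (2 * A + B * s) * (y * y)) -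
      (A ^ 2 * uv + B * (2 * A + B * s) * (x * y)) ^ 2 =
      A ^ 2 * (A ^ 2 * Q + B * (2 * A + B * s) * T) := by rw [hQd, hTd]; ring
  have e2 : (A * uu + B * x * x) * (A * vv + B * y * y) -
      (A * uv + B * y * x) * (A * uv + B * x * y) = A * (A * Q + B * T) := by rw [hQd, hTd]; ring
  rw [e1, e2]
  -- The case `s = 0` is a pole, where `B = 0` and both principal radii equal `A`.
  rcases hs.eq_or_lt with h0 | hpos
  · rw [hB h0.symm]
    have : A ^ 2 ≤ 1 := by nlinarith
    nlinarith [mul_nonneg (sq_nonneg A) hQ]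
  -- After multiplication by `s`, both sides split into a part `s Q - T` from the parallels and a
  -- part `T` from the planes containing the meridian, both nonnegative. The needed bounds are then
  -- `A² ≤ 1` and `A l ≤ 1` separately.
  · refine le_of_mul_le_mul_left ?_ hpos
    have hR : 0 ≤ s * Q - T := by linarith
    set l := A + B * s with hld
    have e3 : s * (A ^ 2 * (A ^ 2 * Q + B * (2 * A + B * s) * T)) =
        A ^ 2 * (A ^ 2 * (s * Q - T) + l ^ 2 * T) := by rw [hld]; ring
    have e4 : s * (A * (A * Q + B * T)) = A ^ 2 * (s * Q - T) + A * l * T := by rw [hld]; ring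
    rw [e3, e4]
    have h1 : A ^ 2 ≤ 1 := by nlinarith
    have h2 : A ^ 2 * (A ^ 2 * (s * Q - T)) ≤ A ^ 2 * (s * Q - T) := by
      nlinarith [mul_nonneg (sq_nonneg A) hR]
    have h3 : (A * l) * (A * l * T) ≤ A * l * T := by
      have : 0 ≤ A * l * T := by positivity
      nlinarith
    nlinarith

/-- The image of `p` in the hypersurface of revolution whose Gauss map is inverted by `revMap`. -/
def gaussInv (n : ℕ) (a b : ℝ → ℝ) (p : UnitSph n) : EucSp (n + 1) := revMap a b p

lemma norm_coe_unitSph (p : UnitSph n) : ‖(p : EucSp (n + 1))‖ = 1 := by simp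

lemma contMDiff_coe_unitSph :
    ContMDiff (𝓡 n) 𝓘(ℝ, EucSp (n + 1)) ∞ ((↑) : UnitSph n → EucSp (n + 1)) := by
  have : Fact (Module.finrank ℝ (EucSp (n + 1)) = n + 1) := ⟨finrank_euclideanSpace_fin⟩
  exact contMDiff_coe_sphere

lemma contMDiff_gaussInv (h : IsGaussProfile a b) :
    ContMDiff (𝓡 n) 𝓘(ℝ, EucSp (n + 1)) ∞ (gaussInv n a b) :=
  (contDiff_revMap h.smooth_a h.smooth_b).contMDiff.comp contMDiff_coe_unitSph

lemma inner_mvfderiv_coe_self (p : UnitSph n) (u : TangentSpace (𝓡 n) p) :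
    inner ℝ (mvfderiv (𝓡 n) ((↑) : UnitSph n → EucSp (n + 1)) p u) (p : EucSp (n + 1)) = 0 := by
  have : Fact (Module.finrank ℝ (EucSp (n + 1)) = n + 1) := ⟨finrank_euclideanSpace_fin⟩
  have h := range_mvfderiv_subtypeVal (n := n) p
  have h2 : mvfderiv (𝓡 n) ((↑) : UnitSph n → EucSp (n + 1)) p u ∈
      (Submodule.span ℝ {(p : EucSp (n + 1))})ᗮ := by
    rw [← h]; exact ⟨u, rfl⟩
  rw [real_inner_comm]
  exact Submodule.mem_orthogonal_singleton_iff_inner_right.mp h2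

lemma mvfderiv_coe_unitSph_injective (p : UnitSph n) :
    Function.Injective (mvfderiv (𝓡 n) ((↑) : UnitSph n → EucSp (n + 1)) p) := by
  have : Fact (Module.finrank ℝ (EucSp (n + 1)) = n + 1) := ⟨finrank_euclideanSpace_fin⟩
  exact injective_mvfderiv_subtypeVal_sphere p

lemma mvfderiv_comp_coe {G : EucSp (n + 1) → EucSp (n + 1)} (hG : ContDiff ℝ ∞ G) (p : UnitSph n)
    (u : TangentSpace (𝓡 n) p) :
    mvfderiv (𝓡 n) (fun q : UnitSph n => G q) p u =
      fderiv ℝ G p (mvfderiv (𝓡 n) ((↑) : UnitSph n → EucSp (n + 1)) p u) := by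
  have h := mfderiv_comp_apply (I := 𝓡 n) (I' := 𝓘(ℝ, EucSp (n + 1)))
    (I'' := 𝓘(ℝ, EucSp (n + 1))) (g := G) (f := ((↑) : UnitSph n → EucSp (n + 1))) p
    (hG.contMDiff.mdifferentiableAt (by simp))
    (contMDiff_coe_unitSph.mdifferentiableAt (by simp)) u
  rw [mfderiv_eq_fderiv] at h
  exact h

lemma mvfderiv_gaussInv (h : IsGaussProfile a b) (p : UnitSph n) (u : TangentSpace (𝓡 n) p) :
    mvfderiv (𝓡 n) (gaussInv n a b) p u = fderiv ℝ (revMap a b) p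
      (mvfderiv (𝓡 n) ((↑) : UnitSph n → EucSp (n + 1)) p u) :=
  mvfderiv_comp_coe (contDiff_revMap h.smooth_a h.smooth_b) p u

/-- This is the Gram inequality for `u`, `v` and the projection of the axis to the tangent space at
`p`, whose squared length is `1 - z²`. -/
lemma gram_projection_le {p u v : EucSp (n + 1)} (hp : ‖p‖ = 1) (hu : inner ℝ u p = 0)
    (hv : inner ℝ v p = 0) :
    v (Fin.last n) ^ 2 * inner ℝ u u + u (Fin.last n) ^ 2 * inner ℝ v v -
      2 * u (Fin.last n) * v (Fin.last n) * inner ℝ u v ≤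
    (1 - p (Fin.last n) ^ 2) * (inner ℝ u u * inner ℝ v v - inner ℝ u v ^ 2) := by
  have hpp : inner ℝ p p = (1 : ℝ) := by rw [real_inner_self_eq_norm_sq, hp]; norm_num
  have h := gram_three_nonneg u v (axisVec n - p (Fin.last n) • p)
  have he : inner ℝ (axisVec n - p (Fin.last n) • p) (axisVec n - p (Fin.last n) • p) =
      1 - p (Fin.last n) ^ 2 := by
    rw [inner_sub_left, inner_sub_right, inner_sub_right, real_inner_smul_left,
      real_inner_smul_left, real_inner_smul_right, real_inner_smul_right, hpp,
      real_inner_comm p (axisVec n), inner_axisVec, inner_axisVec]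
    simp only [PiLp.single_apply, if_true]
    ring
  rw [he] at h
  simpa only [inner_sub_right, real_inner_smul_right, inner_axisVec, hu, hv, mul_zero, sub_zero]
    using h

lemma sq_last_le {p w : EucSp (n + 1)} (hp : ‖p‖ = 1) (hw : inner ℝ w p = 0) :
    w (Fin.last n) ^ 2 ≤ (1 - p (Fin.last n) ^ 2) * inner ℝ w w := by
  have hpp : inner ℝ p p = (1 : ℝ) := by rw [real_inner_self_eq_norm_sq, hp]; norm_num
  have h := gram_three_nonneg p w (axisVec n)
  simp only [inner_axisVec, hpp, real_inner_comm w p, hw] at h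
  simp only [PiLp.single_apply, if_true] at h
  linarith

/-- The second fundamental form is `a |w|² + b' w_z²` with `0 ≤ w_z² ≤ (1 - z²) |w|²`. It therefore
lies between `a |w|²` and `(a + b' (1 - z²)) |w|²`, both positive for `w ≠ 0`. -/
lemma eq_zero_of_fderiv_revMap_eq_zero (h : IsGaussProfile a b) {p w : EucSp (n + 1)}
    (hp : ‖p‖ = 1) (hw : inner ℝ w p = 0) (h0 : fderiv ℝ (revMap a b) p w = 0) : w = 0 := by
  have h1 := inner_fderiv_revMap h hp hw w
  rw [h0, inner_zero_left] at h1
  have h2 := sq_last_le hp hw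
  have hz := last_mem_Icc hp
  have h3 := h.a_pos _ hz
  have h4 := h.meridian_pos _ hz
  by_contra hne
  have h5 : 0 < inner ℝ w w := real_inner_self_pos.mpr hne
  rcases le_total 0 (deriv b (p (Fin.last n))) with hb | hb
  · nlinarith [mul_pos h3 h5, mul_nonneg hb (sq_nonneg (w (Fin.last n)))]
  · nlinarith [mul_pos h4 h5, mul_le_mul_of_nonpos_left h2 hb]

lemma mvfderiv_gaussInv_injective (h : IsGaussProfile a b) (p : UnitSph n) :
    Function.Injective (mvfderiv (𝓡 n) (gaussInv n a b) p) := by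
  refine (injective_iff_map_eq_zero _).mpr fun u hu => ?_
  rw [mvfderiv_gaussInv h] at hu
  have := eq_zero_of_fderiv_revMap_eq_zero h (norm_coe_unitSph p) (inner_mvfderiv_coe_self p u) hu
  apply mvfderiv_coe_unitSph_injective p
  rw [this, map_zero]

/-- The metric on the sphere induced by `gaussInv`. -/
def revMetric (n : ℕ) (h : IsGaussProfile a b) : SmoothRiemMetric n (UnitSph n) :=
  inducedMetric (gaussInv n a b) (contMDiff_gaussInv h) (mvfderiv_gaussInv_injective h)

/-- The inclusion of the sphere serves as the unit normal field, so the second fundamental form is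
`⟨dF u, v⟩`. -/
lemma sectionalCurvatureGE_revMetric (h : IsGaussProfile a b) :
    SectionalCurvatureGE (revMetric n h) 1 := by
  refine sectionalCurvatureGE_inducedMetric _ (fun p : UnitSph n => (p : EucSp (n + 1))) _
    contMDiff_coe_unitSph _ norm_coe_unitSph (fun p u => ?_) 1 fun p u v => ?_
  · rw [mvfderiv_gaussInv h]
    exact inner_fderiv_revMap_self h (norm_coe_unitSph p) (inner_mvfderiv_coe_self p u)
  · have hp := norm_coe_unitSph p
    have hu := inner_mvfderiv_coe_self p u
    have hv := inner_mvfderiv_coe_self p v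
    simp only [mvfderiv_gaussInv h, one_mul]
    set U := mvfderiv (𝓡 n) ((↑) : UnitSph n → EucSp (n + 1)) p u
    set V := mvfderiv (𝓡 n) ((↑) : UnitSph n → EucSp (n + 1)) p v
    rw [inner_fderiv_revMap_fderiv_revMap h hp hu hu, inner_fderiv_revMap_fderiv_revMap h hp hv hv,
      inner_fderiv_revMap_fderiv_revMap h hp hu hv, inner_fderiv_revMap h hp hu,
      inner_fderiv_revMap h hp hv, inner_fderiv_revMap h hp hu, inner_fderiv_revMap h hp hv,
      real_inner_comm U V]
    have hz := last_mem_Icc hp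
    have hT := gram_projection_le hp hu hv
    set z := (p : EucSp (n + 1)) (Fin.last n)
    refine gauss_profile_inequality (h.a_pos _ hz) (h.a_le_one _ hz)
      (s := 1 - z ^ 2) (by nlinarith [hz.1, hz.2]) (h.mul_le_one _ hz) (h.meridian_pos _ hz)
      (fun h0 => h.deriv_b_eq_zero z (by linarith)) hT ?_ ?_
    · have := real_inner_self_nonneg (x := V (Fin.last n) • U - U (Fin.last n) • V)
      simp only [inner_sub_left, inner_sub_right, real_inner_smul_left, real_inner_smul_right,
        real_inner_comm U V] at this
      linarith
    · have := real_inner_mul_inner_self_le U V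
      nlinarith
end
end

/-! ### Injectivity, symmetry, image and diameter of the embedding. -/

noncomputable section

section
variable {n : ℕ} {a b : ℝ → ℝ}

lemma revMap_last (y : EucSp (n + 1)) : revMap a b y (Fin.last n) =
    a (y (Fin.last n)) * y (Fin.last n) + b (y (Fin.last n)) := by
  simp [revMap]

lemma revMap_castSucc (y : EucSp (n + 1)) (i : Fin n) :
    revMap a b y i.castSucc = a (y (Fin.last n)) * y i.castSucc := by
  simp [revMap, (Fin.castSucc_lt_last i).ne]

lemma sum_castSucc_sq (y : EucSp (n + 1)) :
    ∑ i : Fin n, y i.castSucc ^ 2 = ‖y‖ ^ 2 - y (Fin.last n) ^ 2 := by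
  rw [EuclideanSpace.real_norm_sq_eq, Fin.sum_univ_castSucc]
  ring

/-- By `a' = -z b'` the derivative of the height is the meridian radius `a + b' (1 - z²)`. -/
lemma strictMonoOn_height (h : IsGaussProfile a b) :
    StrictMonoOn (fun z => a z * z + b z) (Set.Icc (-1) 1) := by
  have hd : ∀ z, HasDerivAt (fun z => a z * z + b z) (deriv a z * z + a z * 1 + deriv b z) z :=
    fun z => ((h.smooth_a.differentiable (by simp) z).hasDerivAt.mul (hasDerivAt_id z)).add
      (h.smooth_b.differentiable (by simp) z).hasDerivAt
  refine strictMonoOn_of_deriv_pos (convex_Icc _ _)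
    (fun z _ => (hd z).continuousAt.continuousWithinAt) fun z hz => ?_
  have hz' := interior_subset hz
  rw [(hd z).deriv, h.deriv_a z hz']
  have := h.meridian_pos z hz'
  linarith

/-- The height determines `z`, and then `p` is recovered because `a z ≠ 0`. -/
lemma gaussInv_injective (h : IsGaussProfile a b) : Function.Injective (gaussInv n a b) := by
  intro p q hpq
  unfold gaussInv at hpq
  have h1 := congrArg (fun y : EucSp (n + 1) => y (Fin.last n)) hpq
  simp only [revMap_last] at h1
  have hz := (strictMonoOn_height h).injOn (last_mem_Icc (norm_coe_unitSph p))
    (last_mem_Icc (norm_coe_unitSph q)) h1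
  have ha := h.a_pos _ (last_mem_Icc (norm_coe_unitSph p))
  unfold revMap at hpq
  rw [← hz] at hpq
  exact Subtype.ext (smul_right_injective _ ha.ne' (add_right_cancel hpq))

lemma isSmoothIsometricEmbedding_gaussInv (h : IsGaussProfile a b) :
    IsSmoothIsometricEmbedding (revMetric n h) (gaussInv n a b) where
  smooth := contMDiff_gaussInv h
  injective := gaussInv_injective h
  isometric _ _ _ := rfl

lemma FixesAxis.apply_last {A : EucSp (n + 1) ≃ₗᵢ[ℝ] EucSp (n + 1)} (hA : FixesAxis A)
    (y : EucSp (n + 1)) : A y (Fin.last n) = y (Fin.last n) := by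
  rw [← inner_axisVec, ← inner_axisVec]
  have h : A (axisVec n) = axisVec n := hA
  conv_lhs => rw [← h]
  exact A.inner_map_map _ _

lemma revMap_equivariant {A : EucSp (n + 1) ≃ₗᵢ[ℝ] EucSp (n + 1)} (hA : FixesAxis A)
    (y : EucSp (n + 1)) : revMap a b (A y) = A (revMap a b y) := by
  unfold revMap
  rw [hA.apply_last, map_add, map_smul, map_smul, show A (axisVec n) = axisVec n from hA]

lemma isRotationallyEquivariant_gaussInv : IsRotationallyEquivariant (gaussInv n a b) :=
  fun _ hA p => revMap_equivariant hA p

lemma contMDiff_sphMap (A : EucSp (n + 1) ≃ₗᵢ[ℝ] EucSp (n + 1)) :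
    ContMDiff (𝓡 n) (𝓡 n) ∞ (sphMap A) := by
  have : Fact (Module.finrank ℝ (EucSp (n + 1)) = n + 1) := ⟨finrank_euclideanSpace_fin⟩
  exact (A.contDiff.contMDiff.comp contMDiff_coe_unitSph).codRestrict_sphere _

/-- A metric induced by an equivariant embedding is invariant. -/
lemma isRotationallySymmetric_revMetric (h : IsGaussProfile a b) :
    IsRotationallySymmetric (revMetric n h) := by
  intro A hA p u v
  have key : ∀ w : TangentSpace (𝓡 n) p, mvfderiv (𝓡 n) (gaussInv n a b) (sphMap A p)
      (mfderiv (𝓡 n) (𝓡 n) (sphMap A) p w) = A (mvfderiv (𝓡 n) (gaussInv n a b) p w) := by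
    intro w
    have h1 := mfderiv_comp_apply (I := 𝓡 n) (I' := 𝓡 n)
      (I'' := 𝓘(ℝ, EucSp (n + 1))) (g := gaussInv n a b) (f := sphMap A) p
      ((contMDiff_gaussInv h).mdifferentiableAt (by simp))
      ((contMDiff_sphMap A).mdifferentiableAt (by simp)) w
    have h2 := mfderiv_comp_apply (I := 𝓡 n) (I' := 𝓘(ℝ, EucSp (n + 1)))
      (I'' := 𝓘(ℝ, EucSp (n + 1))) (g := A) (f := gaussInv n a b) p
      (A.contDiff.contMDiff.mdifferentiableAt one_ne_zero)
      ((contMDiff_gaussInv h).mdifferentiableAt (by simp)) w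
    have h3 : gaussInv n a b ∘ sphMap A = A ∘ gaussInv n a b :=
      funext fun q => isRotationallyEquivariant_gaussInv A hA q
    rw [h3] at h1
    rw [mfderiv_eq_fderiv, LinearIsometryEquiv.fderiv] at h2
    exact h1.symm.trans h2
  calc _ = inner ℝ (A (mvfderiv (𝓡 n) (gaussInv n a b) p u))
        (A (mvfderiv (𝓡 n) (gaussInv n a b) p v)) := by rw [← key u, ← key v]; rfl
    _ = _ := A.inner_map_map _ _

/-- Both sets are rotation invariant, so it suffices to match squared radius and height along the
profile curves. -/
lemma range_gaussInv (h : IsGaussProfile a b) {c : ℝ} {r : ℝ → ℝ}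
    (h1 : ∀ z ∈ Set.Icc (-1 : ℝ) 1, ∃ t ∈ Set.Icc (-c) c, a z ^ 2 * (1 - z ^ 2) = r t ^ 2 ∧
      a z * z + b z = ∫ s in (0 : ℝ)..t, √(1 - deriv r s ^ 2))
    (h2 : ∀ t ∈ Set.Icc (-c) c, ∃ z ∈ Set.Icc (-1 : ℝ) 1, a z ^ 2 * (1 - z ^ 2) = r t ^ 2 ∧
      a z * z + b z = ∫ s in (0 : ℝ)..t, √(1 - deriv r s ^ 2)) :
    Set.range (gaussInv n a b) = hypersurfaceOfRevolution n c r := by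
  ext y
  constructor
  · rintro ⟨p, rfl⟩
    obtain ⟨t, ht, hr, hZ⟩ := h1 _ (last_mem_Icc (norm_coe_unitSph p))
    refine ⟨t, ht, ?_, ?_⟩
    · simp only [gaussInv, revMap_castSucc, mul_pow, ← Finset.mul_sum]
      rw [sum_castSucc_sq, norm_coe_unitSph, ← hr]
      ring
    · rw [← hZ]
      exact revMap_last _
  · rintro ⟨t, ht, hr, hZ⟩
    obtain ⟨z, hz, hr', hZ'⟩ := h2 t ht
    have ha := h.a_pos z hz
    -- The only candidate for a preimage, obtained by solving `y = a z • p + b z • e` for `p`.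
    set p : EucSp (n + 1) := (a z)⁻¹ • (y - b z • axisVec n) with hpd
    have hlast : p (Fin.last n) = z := by
      have : p (Fin.last n) = (a z)⁻¹ * (y (Fin.last n) - b z) := by simp [hpd]
      rw [this, hZ, ← hZ']
      field_simp
      ring
    have hcast : ∀ i : Fin n, p i.castSucc = (a z)⁻¹ * y i.castSucc := fun i => by
      simp [hpd, (Fin.castSucc_lt_last i).ne]
    have hnorm : ‖p‖ = 1 := by
      have h3 := sum_castSucc_sq p
      simp only [hcast, mul_pow, ← Finset.mul_sum, hlast] at h3
      rw [hr, ← hr'] at h3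
      have : ‖p‖ ^ 2 = 1 := by
        field_simp at h3
        linarith
      nlinarith [norm_nonneg p]
    refine ⟨⟨p, by simpa using hnorm⟩, ?_⟩
    simp only [gaussInv, revMap, hlast]
    rw [hpd, smul_smul, mul_inv_cancel₀ ha.ne', one_smul, sub_add_cancel]

lemma height_sub_le_diam (h : IsGaussProfile a b) :
    (a 1 * 1 + b 1) - (a (-1) * (-1) + b (-1)) ≤ diamOfEmbedding (gaussInv n a b) := by
  have hb : Bornology.IsBounded (Set.range (gaussInv n a b)) :=
    (isCompact_range (contMDiff_gaussInv h).continuous).isBounded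
  let N : UnitSph n := ⟨axisVec n, by simp⟩
  let S : UnitSph n := ⟨-axisVec n, by simp⟩
  have h1 := Metric.dist_le_diam_of_mem hb (Set.mem_range_self N) (Set.mem_range_self S)
  refine le_trans ?_ h1
  rw [dist_eq_norm]
  refine le_trans ?_ (PiLp.norm_apply_le _ (Fin.last n))
  rw [PiLp.sub_apply]
  simp only [gaussInv, revMap_last]
  simp only [N, S, PiLp.neg_apply, PiLp.single_apply, if_true]
  exact le_abs_self _
end
end

/-! ### The equation `f'' + f = h` and profiles with a steep end. -/

noncomputable section

open MeasureTheory intervalIntegral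

section
variable {h : ℝ → ℝ}

/-- The solution of `f'' + f = h`, `f 0 = 1`, `f' 0 = 0`. -/
def oscSol (h : ℝ → ℝ) (t : ℝ) : ℝ :=
  Real.cos t + Real.sin t * (∫ s in (0 : ℝ)..t, Real.cos s * h s) -
    Real.cos t * ∫ s in (0 : ℝ)..t, Real.sin s * h s

lemma hasDerivAt_primitive {g : ℝ → ℝ} (hg : Continuous g) (t : ℝ) :
    HasDerivAt (fun t => ∫ s in (0 : ℝ)..t, g s) (g t) t :=
  integral_hasDerivAt_right (hg.intervalIntegrable _ _)
    hg.stronglyMeasurable.stronglyMeasurableAtFilter hg.continuousAt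

lemma contDiff_primitive {g : ℝ → ℝ} (hg : ContDiff ℝ ∞ g) :
    ContDiff ℝ ∞ (fun t => ∫ s in (0 : ℝ)..t, g s) := by
  rw [contDiff_infty_iff_deriv]
  refine ⟨fun t => (hasDerivAt_primitive hg.continuous t).differentiableAt, ?_⟩
  rw [show deriv (fun t => ∫ s in (0 : ℝ)..t, g s) = g from
    funext fun t => (hasDerivAt_primitive hg.continuous t).deriv]
  exact hg

lemma contDiff_oscSol (hh : ContDiff ℝ ∞ h) : ContDiff ℝ ∞ (oscSol h) :=
  (Real.contDiff_cos.add (Real.contDiff_sin.mul (contDiff_primitive (Real.contDiff_cos.mul hh)))).sub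
    (Real.contDiff_cos.mul (contDiff_primitive (Real.contDiff_sin.mul hh)))

lemma hasDerivAt_oscSol (hh : Continuous h) (t : ℝ) :
    HasDerivAt (oscSol h) (-Real.sin t + Real.cos t * (∫ s in (0 : ℝ)..t, Real.cos s * h s) +
      Real.sin t * ∫ s in (0 : ℝ)..t, Real.sin s * h s) t := by
  have h1 := hasDerivAt_primitive (Real.continuous_cos.mul hh) t
  have h2 := hasDerivAt_primitive (Real.continuous_sin.mul hh) t
  have h3 := ((Real.hasDerivAt_cos t).add ((Real.hasDerivAt_sin t).mul h1)).sub
    ((Real.hasDerivAt_cos t).mul h2)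
  refine HasDerivAt.congr_deriv h3 ?_
  simp only [Pi.mul_apply]
  ring

lemma deriv_oscSol (hh : Continuous h) : deriv (oscSol h) = fun t =>
    -Real.sin t + Real.cos t * (∫ s in (0 : ℝ)..t, Real.cos s * h s) +
      Real.sin t * ∫ s in (0 : ℝ)..t, Real.sin s * h s :=
  funext fun t => (hasDerivAt_oscSol hh t).deriv

lemma oscSol_ode (hh : Continuous h) (t : ℝ) :
    deriv (deriv (oscSol h)) t + oscSol h t = h t := by
  rw [deriv_oscSol hh]
  have h1 := hasDerivAt_primitive (Real.continuous_cos.mul hh) t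
  have h2 := hasDerivAt_primitive (Real.continuous_sin.mul hh) t
  have h3 := ((Real.hasDerivAt_sin t).neg.add ((Real.hasDerivAt_cos t).mul h1)).add
    ((Real.hasDerivAt_sin t).mul h2)
  have h4 : HasDerivAt (fun t : ℝ => -Real.sin t +
      Real.cos t * (∫ s in (0 : ℝ)..t, Real.cos s * h s) +
      Real.sin t * ∫ s in (0 : ℝ)..t, Real.sin s * h s) _ t := h3
  rw [h4.deriv]
  simp only [Pi.mul_apply, oscSol]
  linear_combination h t * Real.sin_sq_add_cos_sq t

lemma oscSol_neg (hev : ∀ t, h (-t) = h t) (t : ℝ) : oscSol h (-t) = oscSol h t := by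
  have h1 : (∫ s in (0 : ℝ)..(-t), Real.cos s * h s) = -∫ s in (0 : ℝ)..t, Real.cos s * h s := by
    have := intervalIntegral.integral_comp_neg (a := 0) (b := t) (fun s => Real.cos s * h s)
    simp only [Real.cos_neg, hev, neg_zero] at this
    rw [this, integral_symm]
  have h2 : (∫ s in (0 : ℝ)..(-t), Real.sin s * h s) = ∫ s in (0 : ℝ)..t, Real.sin s * h s := by
    have := intervalIntegral.integral_comp_neg (a := 0) (b := t) (fun s => Real.sin s * h s)
    simp only [Real.sin_neg, hev, neg_zero, neg_mul, intervalIntegral.integral_neg] at this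
    rw [integral_symm, ← this, neg_neg]
  simp only [oscSol, h1, h2, Real.cos_neg, Real.sin_neg]
  ring

/-- An even nonpositive smooth function with mass `L` on each side, concentrated on
`a < |t| < a + 2w`. -/
lemma exists_cutoff (a w L : ℝ) (ha : 0 < a) (hw : 0 < w) (hL : 0 < L) :
    ∃ h : ℝ → ℝ, ContDiff ℝ ∞ h ∧ (∀ t, h t ≤ 0) ∧ (∀ t, h (-t) = h t) ∧
      (∀ t, h t ≠ 0 → a < |t| ∧ |t| < a + 2 * w) ∧
      (∀ t, 0 ≤ t → -L ≤ ∫ s in (0 : ℝ)..t, h s) ∧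
      (∫ s in (0 : ℝ)..(a + 2 * w), h s) = -L := by
  -- Centre `a + w` and outer radius `w` place the bump on `(a, a + 2w)`; it is normalized to mass
  -- one, scaled by `-L` and reflected.
  let ψ : ContDiffBump (a + w) := ⟨w / 2, w, by linarith, by linarith⟩
  set φ : ℝ → ℝ := ψ.normed volume with hφ
  have hφs : ∀ t, φ t ≠ 0 → a < t ∧ t < a + 2 * w := fun t ht => by
    have h1 : t ∈ Function.support φ := ht
    rw [hφ, ψ.support_normed_eq, Metric.mem_ball, Real.dist_eq, abs_lt] at h1
    simp only [ψ] at h1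
    constructor <;> linarith [h1.1, h1.2]
  have hφ0 : ∀ t, 0 ≤ φ t := fun t => ψ.nonneg_normed t
  have hφc : ContDiff ℝ ∞ φ := ψ.contDiff_normed
  have hneg : ∀ s, 0 ≤ s → φ (-s) = 0 := fun s hs => by
    by_contra hne
    linarith [(hφs _ hne).1]
  have hint : Integrable φ := ψ.integrable_normed
  have hI : ∀ t, 0 ≤ t → (∫ s in (0 : ℝ)..t, -L * (φ s + φ (-s))) = -L * ∫ s in (0 : ℝ)..t, φ s := by
    intro t ht
    rw [← intervalIntegral.integral_const_mul]
    refine intervalIntegral.integral_congr fun s hs => ?_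
    rw [Set.uIcc_of_le ht] at hs
    simp only [hneg s hs.1, add_zero]
  refine ⟨fun t => -L * (φ t + φ (-t)), ?_, ?_, ?_, ?_, ?_, ?_⟩
  · exact contDiff_const.mul (hφc.add (hφc.comp contDiff_neg))
  · intro t
    nlinarith [mul_nonneg hL.le (add_nonneg (hφ0 t) (hφ0 (-t)))]
  · intro t; simp only [neg_neg]; ring
  · intro t ht
    by_cases h1 : φ t = 0
    · by_cases h2 : φ (-t) = 0
      · simp [h1, h2] at ht
      · have := hφs _ h2
        rw [abs_of_nonpos (by linarith)]
        exact this
    · have := hφs _ h1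
      rw [abs_of_nonneg (by linarith)]
      exact this
  · intro t ht
    rw [hI t ht]
    have h1 : ∫ s in (0 : ℝ)..t, φ s ≤ 1 := by
      rw [integral_of_le ht, ← ψ.integral_normed (μ := volume)]
      exact setIntegral_le_integral hint (Filter.Eventually.of_forall hφ0)
    nlinarith
  · rw [hI _ (by linarith)]
    have h1 : ∫ s in (0 : ℝ)..(a + 2 * w), φ s = 1 := by
      rw [← ψ.integral_normed (μ := volume), integral_eq_integral_of_support_subset]
      intro t ht
      have h1 : t ∈ Function.support φ := ht
      have := hφs t h1
      exact ⟨by linarith, this.2.le⟩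
    rw [h1, mul_one]

/-- Smooth cutoff profiles which agree with `cos` on `[-a, a]` and with `A sin (c - t)` near the
first zero `c`, with `A` arbitrarily large. -/
lemma exists_oscSol_steep (a Λ : ℝ) (ha : 0 < a) (ha2 : a < Real.pi / 2) (hΛ : 0 < Λ) :
    ∃ (c A a₁ : ℝ) (h f : ℝ → ℝ), ContDiff ℝ ∞ h ∧ (∀ t, h t ≤ 0) ∧ (∀ t, h (-t) = h t) ∧
      (∀ t, h t ≠ 0 → a < |t| ∧ |t| < a₁) ∧ a < a₁ ∧ a₁ < c ∧ c ≤ Real.pi / 2 ∧ ContDiff ℝ ∞ f ∧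
      (∀ t, deriv (deriv f) t + f t = h t) ∧ f 0 = 1 ∧ deriv f 0 = 0 ∧ (∀ t, f (-t) = f t) ∧
      (∀ t ∈ Set.Ioo (-c) c, 0 < f t) ∧ Λ ≤ A ∧ (∀ t, a₁ ≤ t → f t = A * Real.sin (c - t)) ∧
      (∀ t ∈ Set.Icc 0 a, f t = Real.cos t) := by
  have hsa : 0 < Real.sin a := Real.sin_pos_of_pos_of_lt_pi ha (by linarith [Real.pi_pos])
  have hca : 0 < Real.cos a := Real.cos_pos_of_mem_Ioo ⟨by linarith, ha2⟩
  -- On the support of `h` in `t > 0` one has `sin ≥ sin a`, so mass `L` there forces `∫ sin · h ≤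
  -- -L sin a = -Λ`, which makes the final amplitude at least `Λ`.
  set L := Λ / Real.sin a with hLd
  have hL : 0 < L := div_pos hΛ hsa
  have hLs : L * Real.sin a = Λ := div_mul_cancel₀ _ hsa.ne'
  -- Since `f' ≥ -(1 + 2L)` up to `a + 2w`, the solution falls by less than its value `cos a` while
  -- the force acts, and so stays positive.
  obtain ⟨w, hw, hw1, hw2⟩ : ∃ w : ℝ, 0 < w ∧ 2 * w * (1 + 2 * L) < Real.cos a ∧
      a + 2 * w < Real.pi / 2 := by
    refine ⟨min (Real.cos a / (4 * (1 + 2 * L))) ((Real.pi / 2 - a) / 4), ?_, ?_, ?_⟩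
    · exact lt_min (by positivity) (by linarith)
    · have h1 := min_le_left (Real.cos a / (4 * (1 + 2 * L))) ((Real.pi / 2 - a) / 4)
      rw [le_div_iff₀ (by positivity)] at h1
      nlinarith
    · have := min_le_right (Real.cos a / (4 * (1 + 2 * L))) ((Real.pi / 2 - a) / 4)
      linarith
  obtain ⟨h, hh, hneg, hev, hsupp, hmass, htot⟩ := exists_cutoff a w L ha hw hL
  set a₁ := a + 2 * w with ha₁
  have hc := hh.continuous
  have hcos := Real.continuous_cos.mul hc
  have hsin := Real.continuous_sin.mul hc
  set C : ℝ → ℝ := fun t => ∫ s in (0 : ℝ)..t, Real.cos s * h s with hC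
  set S : ℝ → ℝ := fun t => ∫ s in (0 : ℝ)..t, Real.sin s * h s with hS
  have hf : ∀ t, oscSol h t = Real.cos t + Real.sin t * C t - Real.cos t * S t := fun t => rfl
  have hlow : ∀ g : ℝ → ℝ, Continuous g → (∀ s, g s ≤ 1) → ∀ t, 0 ≤ t →
      -L ≤ ∫ s in (0 : ℝ)..t, g s * h s := fun g hg hg1 t ht => by
    refine (hmass t ht).trans (intervalIntegral.integral_mono_on ht (hc.intervalIntegrable _ _)
      ((hg.mul hc).intervalIntegrable _ _) fun s _ => ?_)
    nlinarith [hneg s, hg1 s]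
  have hzero : ∀ g : ℝ → ℝ, ∀ t ∈ Set.Icc 0 a, ∫ s in (0 : ℝ)..t, g s * h s = 0 :=
    fun g t ht => by
      rw [intervalIntegral.integral_congr (g := fun _ => (0 : ℝ)), intervalIntegral.integral_zero]
      intro s hs
      rw [Set.uIcc_of_le ht.1] at hs
      have : h s = 0 := by
        by_contra hne
        have := (hsupp s hne).1
        rw [abs_of_nonneg hs.1] at this
        linarith [hs.2, ht.2]
      simp [this]
  -- Beyond `a₁` the force vanishes, the two integrals are frozen, and `f` is a pure oscillation.
  have hconst : ∀ g : ℝ → ℝ, Continuous g → ∀ t, a₁ ≤ t →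
      ∫ s in (0 : ℝ)..t, g s * h s = ∫ s in (0 : ℝ)..a₁, g s * h s := fun g hg t ht => by
    have hi : ∀ x y, IntervalIntegrable (fun s => g s * h s) volume x y :=
      fun x y => (hg.mul hc).intervalIntegrable x y
    rw [← intervalIntegral.integral_add_adjacent_intervals (hi 0 a₁) (hi a₁ t)]
    rw [intervalIntegral.integral_congr (a := a₁) (g := fun _ => (0 : ℝ)),
      intervalIntegral.integral_zero, add_zero]
    intro s hs
    rw [Set.uIcc_of_le ht] at hs
    have : h s = 0 := by
      by_contra hne
      have := (hsupp s hne).2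
      linarith [hs.1, le_abs_self s]
    simp [this]
  have hcosf : ∀ t ∈ Set.Icc 0 a, oscSol h t = Real.cos t := fun t ht => by
    rw [hf, hC, hS]
    simp only [hzero _ t ht]
    ring
  have hpos1 : ∀ t ∈ Set.Icc 0 a₁, 0 < oscSol h t := by
    intro t ht
    rcases le_total t a with hta | hta
    · rw [hcosf t ⟨ht.1, hta⟩]
      exact Real.cos_pos_of_mem_Ioo ⟨by linarith [ht.1], by linarith⟩
    · have hmv := (convex_Icc a a₁).mul_sub_le_image_sub_of_le_deriv (f := oscSol h)
        (contDiff_oscSol hh).continuous.continuousOn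
        ((contDiff_oscSol hh).differentiable (by simp)).differentiableOn
        (C := -(1 + 2 * L)) (fun x hx => by
          have hx' := interior_subset hx
          have hx0 : 0 ≤ x := by linarith [hx'.1]
          have h1 := hlow _ Real.continuous_cos Real.cos_le_one x hx0
          have h2 := hlow _ Real.continuous_sin Real.sin_le_one x hx0
          have h3 : 0 ≤ Real.cos x := Real.cos_nonneg_of_mem_Icc ⟨by linarith, by linarith [hx'.2]⟩
          have h4 : 0 ≤ Real.sin x := Real.sin_nonneg_of_nonneg_of_le_pi hx0
            (by linarith [hx'.2, Real.pi_pos])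
          rw [deriv_oscSol hc]
          nlinarith [Real.sin_le_one x, Real.cos_le_one x, mul_le_mul_of_nonneg_left h1 h3,
            mul_le_mul_of_nonneg_left h2 h4])
        a ⟨le_rfl, by linarith⟩ t ⟨hta, ht.2⟩ hta
      rw [hcosf a ⟨ha.le, le_rfl⟩] at hmv
      have : (1 + 2 * L) * (t - a) ≤ (1 + 2 * L) * (2 * w) :=
        mul_le_mul_of_nonneg_left (by linarith [ht.2]) (by positivity)
      linarith
  have hCa : C a₁ ≤ 0 := by
    have := intervalIntegral.integral_mono_on (a := 0) (b := a₁) (f := fun s => Real.cos s * h s)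
      (g := fun _ => 0) (μ := volume) (by linarith) (hcos.intervalIntegrable _ _)
      (continuous_const.intervalIntegrable _ _) (fun s hs => mul_nonpos_of_nonneg_of_nonpos
        (Real.cos_nonneg_of_mem_Icc ⟨by linarith [hs.1], by linarith [hs.2]⟩) (hneg s))
    simpa using this
  have hSa : S a₁ ≤ -Λ := by
    have := intervalIntegral.integral_mono_on (a := 0) (b := a₁) (f := fun s => Real.sin s * h s)
      (g := fun s => Real.sin a * h s) (μ := volume) (by linarith) (hsin.intervalIntegrable _ _)
      ((continuous_const.mul hc).intervalIntegrable _ _) (fun s hs => by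
        by_cases h0 : h s = 0
        · simp [h0]
        · have h1 := (hsupp s h0).1
          rw [abs_of_nonneg hs.1] at h1
          exact mul_le_mul_of_nonpos_right (Real.sin_le_sin_of_le_of_le_pi_div_two
            (by linarith) (by linarith [hs.2]) h1.le) (hneg s))
    rw [intervalIntegral.integral_const_mul, htot] at this
    linarith
  set α := 1 - S a₁ with hα
  set B := -C a₁ with hB
  have hα0 : 0 < α := by linarith
  have hB0 : 0 ≤ B := by linarith
  have htail : ∀ t, a₁ ≤ t → oscSol h t = α * Real.cos t - B * Real.sin t := fun t ht => by
    have h1 : C t = C a₁ := hconst _ Real.continuous_cos t ht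
    have h2 : S t = S a₁ := hconst _ Real.continuous_sin t ht
    rw [hf, h1, h2, hα, hB]
    ring
  -- At `π/2` the tail `α cos t - B sin t` equals `-B ≤ 0`, which gives a zero by the intermediate
  -- value theorem.
  obtain ⟨c, hcI, hc0⟩ : ∃ c ∈ Set.Icc a₁ (Real.pi / 2), oscSol h c = 0 := by
    have := intermediate_value_Icc' hw2.le ((contDiff_oscSol hh).continuous.continuousOn)
    refine this ⟨?_, (hpos1 a₁ ⟨by linarith, le_rfl⟩).le⟩
    rw [htail _ hw2.le]
    simp [hB0]
  have hca₁ : a₁ < c := lt_of_le_of_ne hcI.1 fun he => by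
    have := hpos1 a₁ ⟨by linarith, le_rfl⟩
    rw [he, hc0] at this
    exact lt_irrefl _ this
  have hsc : 0 < Real.sin c := Real.sin_pos_of_pos_of_lt_pi (by linarith)
    (by linarith [hcI.2, Real.pi_pos])
  -- The amplitude of the oscillation when its phase is measured from the zero `c`; it equals
  -- `-f'(c)`.
  set A := α * Real.sin c + B * Real.cos c with hA
  have hrel : α * Real.cos c = B * Real.sin c := by
    have := htail c hcI.1
    linarith
  have hAs : A * Real.sin c = α := by
    rw [hA]
    linear_combination α * Real.sin_sq_add_cos_sq c - Real.cos c * hrel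
  have hAc : A * Real.cos c = B := by
    rw [hA]
    linear_combination B * Real.sin_sq_add_cos_sq c + Real.sin c * hrel
  have hAα : α ≤ A := by
    have hA0 : 0 ≤ A := by
      by_contra hn
      nlinarith
    nlinarith [Real.sin_le_one c]
  have htail' : ∀ t, a₁ ≤ t → oscSol h t = A * Real.sin (c - t) := fun t ht => by
    rw [htail t ht, Real.sin_sub, ← hAs, ← hAc]
    ring
  have hpos2 : ∀ t, 0 ≤ t → t < c → 0 < oscSol h t := fun t ht0 htc => by
    rcases le_total t a₁ with h1 | h1
    · exact hpos1 t ⟨ht0, h1⟩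
    · rw [htail' t h1]
      exact mul_pos (by linarith) (Real.sin_pos_of_pos_of_lt_pi (by linarith)
        (by linarith [hcI.2, Real.pi_pos]))
  refine ⟨c, A, a₁, h, oscSol h, hh, hneg, hev, hsupp, by linarith, hca₁, hcI.2, contDiff_oscSol hh,
    oscSol_ode hc, ?_, ?_, oscSol_neg hev, ?_, by linarith, htail', hcosf⟩
  · simp [oscSol]
  · simp [deriv_oscSol hc]
  · intro t ht
    rcases le_total 0 t with h0 | h0
    · exact hpos2 t h0 ht.2
    · rw [← oscSol_neg hev]
      exact hpos2 (-t) (by linarith) (by linarith [ht.1])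
end
end

/-! ### From a round-ended profile curve to the coefficients of the inverse Gauss map. -/

noncomputable section

open MeasureTheory intervalIntegral

/-- A profile curve `r` of a closed convex hypersurface of revolution which is parametrized by arc
length, ends in unit round caps and satisfies `r'' + r ≤ 0`. -/
structure IsRoundEndedProfile (c a₁ : ℝ) (r : ℝ → ℝ) : Prop where
  a_nonneg : 0 ≤ a₁
  a_lt : a₁ < c
  smooth : ContDiff ℝ ∞ r
  even : ∀ t, r (-t) = r t
  pos : ∀ t ∈ Set.Ioo (-c) c, 0 < r t
  ode : ∀ t ∈ Set.Icc (-c) c, deriv (deriv r) t + r t ≤ 0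
  tail : ∀ t, a₁ ≤ t → r t = Real.sin (c - t)

/-- The height function of the profile curve. -/
def profileHeight (r : ℝ → ℝ) (t : ℝ) : ℝ := ∫ s in (0 : ℝ)..t, √(1 - deriv r s ^ 2)

/-- The inverse of the angle function `-r'`. -/
def angleInv (c : ℝ) (r : ℝ → ℝ) : ℝ → ℝ :=
  Function.invFunOn (fun t => -deriv r t) (Set.Icc (-c) c)

/-- The radial coefficient of the inverse Gauss map. -/
def gaussA (c : ℝ) (r : ℝ → ℝ) (z : ℝ) : ℝ :=
  -- The value `1` beyond the poles extends the unit round caps, where the quotient is already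
  -- identically `1`; this gives smoothness on all of `ℝ`.
  if |z| < 1 then r (angleInv c r z) / √(1 - z ^ 2) else 1

/-- The axial coefficient of the inverse Gauss map. -/
def gaussB (c : ℝ) (r : ℝ → ℝ) (z : ℝ) : ℝ :=
  if |z| < 1 then profileHeight r (angleInv c r z) - gaussA c r z * z
  else SignType.sign z * (profileHeight r c - 1)

namespace IsRoundEndedProfile

variable {c a₁ : ℝ} {r : ℝ → ℝ}

lemma gaussA_of_abs_lt {z : ℝ} (hz : |z| < 1) :
    gaussA c r z = r (angleInv c r z) / √(1 - z ^ 2) := if_pos hz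

lemma gaussA_of_one_le {z : ℝ} (hz : 1 ≤ |z|) : gaussA c r z = 1 := if_neg (not_lt.mpr hz)

lemma gaussB_of_abs_lt {z : ℝ} (hz : |z| < 1) :
    gaussB c r z = profileHeight r (angleInv c r z) - gaussA c r z * z := if_pos hz

lemma gaussB_of_one_le {z : ℝ} (hz : 1 ≤ z) : gaussB c r z = profileHeight r c - 1 := by
  rw [gaussB, if_neg (not_lt.mpr (hz.trans (le_abs_self z))), sign_pos (by linarith)]
  simp

lemma one_sub_sq_pos {z : ℝ} (hz : |z| < 1) : 0 < 1 - z ^ 2 := by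
  have := abs_lt.mp hz
  nlinarith [this.1, this.2]

section
variable (H : IsRoundEndedProfile c a₁ r)
include H

lemma c_pos : 0 < c := H.a_nonneg.trans_lt H.a_lt

lemma contDiff_deriv : ContDiff ℝ ∞ (deriv r) := (contDiff_infty_iff_deriv.mp H.smooth).2

lemma hasDerivAt (t : ℝ) : HasDerivAt r (deriv r t) t :=
  (H.smooth.differentiable (by simp) t).hasDerivAt

lemma hasDerivAt_deriv (t : ℝ) : HasDerivAt (deriv r) (deriv (deriv r) t) t :=
  (H.contDiff_deriv.differentiable (by simp) t).hasDerivAt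

lemma deriv_neg (t : ℝ) : deriv r (-t) = -deriv r t := by
  have h1 : (fun t => r (-t)) = r := funext H.even
  have h2 := deriv_comp_neg r t
  rw [h1] at h2
  linarith

lemma deriv_deriv_neg {t : ℝ} (ht : t ∈ Set.Ioo (-c) c) : deriv (deriv r) t < 0 := by
  linarith [H.pos t ht, H.ode t (Set.Ioo_subset_Icc_self ht)]

lemma deriv_tail {t : ℝ} (ht : a₁ < t) : deriv r t = -Real.cos (c - t) := by
  have h1 : r =ᶠ[nhds t] fun t => Real.sin (c - t) :=
    Filter.eventually_of_mem (Ioi_mem_nhds ht) fun s hs => H.tail s (le_of_lt hs)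
  have h2 : HasDerivAt (fun t => Real.sin (c - t)) (Real.cos (c - t) * (-1)) t :=
    ((hasDerivAt_id t).const_sub c).sin
  rw [h1.deriv_eq, h2.deriv]
  ring

lemma deriv_c : deriv r c = -1 := by simp [H.deriv_tail H.a_lt]

lemma r_c : r c = 0 := by simp [H.tail c H.a_lt.le]

/-- Inside the interval `-r'' ≥ r > 0`, so the profile is strictly concave and `z = -r'` is a global
coordinate on it. -/
lemma strictMonoOn_angle : StrictMonoOn (fun t => -deriv r t) (Set.Icc (-c) c) := by
  refine strictMonoOn_of_deriv_pos (convex_Icc _ _)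
    H.contDiff_deriv.continuous.neg.continuousOn fun t ht => ?_
  rw [interior_Icc] at ht
  rw [(H.hasDerivAt_deriv t).fun_neg.deriv]
  linarith [H.deriv_deriv_neg ht]

lemma deriv_mem_Ioo {t : ℝ} (ht : t ∈ Set.Ioo (-c) c) : -deriv r t ∈ Set.Ioo (-1 : ℝ) 1 := by
  have hc := H.c_pos
  have h1 := H.strictMonoOn_angle (Set.Ioo_subset_Icc_self ht) (Set.right_mem_Icc.mpr (by linarith))
    ht.2
  have h2 := H.strictMonoOn_angle (Set.left_mem_Icc.mpr (by linarith)) (Set.Ioo_subset_Icc_self ht)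
    ht.1
  simp only [H.deriv_neg, H.deriv_c] at h1 h2
  constructor <;> linarith

lemma deriv_mem_Icc {t : ℝ} (ht : t ∈ Set.Icc (-c) c) : -deriv r t ∈ Set.Icc (-1 : ℝ) 1 := by
  have hc := H.c_pos
  have h1 := H.strictMonoOn_angle.monotoneOn ht (Set.right_mem_Icc.mpr (by linarith)) ht.2
  have h2 := H.strictMonoOn_angle.monotoneOn (Set.left_mem_Icc.mpr (by linarith)) ht ht.1
  simp only [H.deriv_neg, H.deriv_c] at h1 h2
  constructor <;> linarith

/-- The profile stays inside the unit circle of the phase plane. -/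
lemma sq_add_deriv_sq_le {t : ℝ} (ht : t ∈ Set.Icc (-c) c) : r t ^ 2 + deriv r t ^ 2 ≤ 1 := by
  have hc := H.c_pos
  -- The derivative is `2 r' (r'' + r)`, a product of two nonpositive factors on `[0, c]`, and the
  -- value at `c` is `1`.
  have key : MonotoneOn (fun t => r t ^ 2 + deriv r t ^ 2) (Set.Icc 0 c) := by
    have hd : ∀ t, HasDerivAt (fun t => r t ^ 2 + deriv r t ^ 2)
        (2 * deriv r t * (deriv (deriv r) t + r t)) t := fun t => by
      refine (((H.hasDerivAt t).pow 2).add ((H.hasDerivAt_deriv t).pow 2)).congr_deriv ?_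
      push_cast
      ring
    refine monotoneOn_of_deriv_nonneg (convex_Icc _ _)
      (fun t _ => (hd t).continuousAt.continuousWithinAt)
      (fun t _ => (hd t).differentiableAt.differentiableWithinAt) fun t ht => ?_
    have ht' := interior_subset ht
    rw [(hd t).deriv]
    have h1 := H.ode t ⟨by linarith [ht'.1], ht'.2⟩
    have h0 : deriv r 0 = 0 := by
      have := H.deriv_neg 0
      rw [neg_zero] at this
      linarith
    have h2 := H.strictMonoOn_angle.monotoneOn (a := 0) (b := t) ⟨by linarith, hc.le⟩
      ⟨by linarith [ht'.1], ht'.2⟩ ht'.1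
    simp only [h0] at h2
    nlinarith
  have main : ∀ t ∈ Set.Icc 0 c, r t ^ 2 + deriv r t ^ 2 ≤ 1 := fun t ht => by
    have := key ht (Set.right_mem_Icc.mpr hc.le) ht.2
    simp only [H.r_c, H.deriv_c] at this
    linarith
  rcases le_total 0 t with h | h
  · exact main t ⟨h, ht.2⟩
  · have := main (-t) ⟨by linarith, by linarith [ht.1]⟩
    rw [H.even, H.deriv_neg] at this
    linarith

lemma angleInv_spec {z : ℝ} (hz : z ∈ Set.Icc (-1 : ℝ) 1) :
    angleInv c r z ∈ Set.Icc (-c) c ∧ -deriv r (angleInv c r z) = z := by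
  have hc := H.c_pos
  have h := intermediate_value_Icc (f := fun t => -deriv r t) (a := -c) (b := c) (by linarith)
    H.contDiff_deriv.continuous.neg.continuousOn
  simp only [H.deriv_neg, H.deriv_c, neg_neg] at h
  exact ⟨Function.invFunOn_mem (h hz), Function.invFunOn_eq (h hz)⟩

lemma angleInv_angle {t : ℝ} (ht : t ∈ Set.Icc (-c) c) : angleInv c r (-deriv r t) = t := by
  have h := H.angleInv_spec (H.deriv_mem_Icc ht)
  exact H.strictMonoOn_angle.injOn h.1 ht h.2

lemma angleInv_mem_Ioo {z : ℝ} (hz : z ∈ Set.Ioo (-1 : ℝ) 1) :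
    angleInv c r z ∈ Set.Ioo (-c) c := by
  have h := H.angleInv_spec (Set.Ioo_subset_Icc_self hz)
  refine ⟨lt_of_le_of_ne h.1.1 fun he => ?_, lt_of_le_of_ne h.1.2 fun he => ?_⟩
  · have := h.2
    rw [← he, H.deriv_neg, H.deriv_c] at this
    linarith [hz.1]
  · have := h.2
    rw [he, H.deriv_c] at this
    linarith [hz.2]

lemma angleInv_neg {z : ℝ} (hz : z ∈ Set.Icc (-1 : ℝ) 1) :
    angleInv c r (-z) = -angleInv c r z := by
  have h := H.angleInv_spec hz
  have h2 : -z = -deriv r (-angleInv c r z) := by rw [H.deriv_neg]; linarith [h.2]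
  rw [h2, H.angleInv_angle ⟨by linarith [h.1.2], by linarith [h.1.1]⟩]

lemma angleInv_one : angleInv c r 1 = c := by
  have := H.angleInv_angle (t := c) ⟨by linarith [H.c_pos], le_rfl⟩
  rwa [H.deriv_c, neg_neg] at this

/-- The inverse function theorem applies because `r'' ≠ 0`; its local inverse agrees with `angleInv`
by injectivity of the angle. -/
lemma angleInv_contDiffAt {z : ℝ} (hz : z ∈ Set.Ioo (-1 : ℝ) 1) :
    ContDiffAt ℝ ∞ (angleInv c r) z := by
  have ht := H.angleInv_mem_Ioo hz
  set t := angleInv c r z with htd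
  have hzt : -deriv r t = z := (H.angleInv_spec (Set.Ioo_subset_Icc_self hz)).2
  have hζ : ContDiffAt ℝ ∞ (fun t => -deriv r t) t := H.contDiff_deriv.neg.contDiffAt
  have hne : -deriv (deriv r) t ≠ 0 := (neg_pos.mpr (H.deriv_deriv_neg ht)).ne'
  have hd := (H.hasDerivAt_deriv t).fun_neg
  have hfd := hd.hasFDerivAt_equiv hne
  have hs := hζ.hasStrictFDerivAt' hfd (by simp)
  have hinv : ContDiffAt ℝ ∞ (hζ.localInverse hfd (by simp)) (-deriv r t) :=
    hζ.to_localInverse hfd (by simp)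
  rw [← hzt]
  refine hinv.congr_of_eventuallyEq ?_
  rw [Filter.EventuallyEq, ← hs.map_nhds_eq_of_equiv, Filter.eventually_map]
  filter_upwards [hs.eventually_left_inverse, Ioo_mem_nhds ht.1 ht.2] with x hx hx'
  rw [H.angleInv_angle (Set.Ioo_subset_Icc_self hx')]
  exact hx.symm

lemma hasDerivAt_angleInv {z : ℝ} (hz : z ∈ Set.Ioo (-1 : ℝ) 1) :
    HasDerivAt (angleInv c r) (-deriv (deriv r) (angleInv c r z))⁻¹ z := by
  have h1 := ((H.angleInv_contDiffAt hz).differentiableAt (by simp)).hasDerivAt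
  have h2 := (H.hasDerivAt_deriv (angleInv c r z)).neg.comp z h1
  have h3 : (fun t => -deriv r t) ∘ angleInv c r =ᶠ[nhds z] id :=
    Filter.eventually_of_mem (Ioo_mem_nhds hz.1 hz.2) fun y hy =>
      (H.angleInv_spec (Set.Ioo_subset_Icc_self hy)).2
  have h4 := (h3.hasDerivAt_iff.mp h2).unique (hasDerivAt_id z)
  rw [← eq_inv_of_mul_eq_one_right h4]
  exact h1

lemma continuous_speed : Continuous fun s => √(1 - deriv r s ^ 2) :=
  (continuous_const.sub (H.contDiff_deriv.continuous.pow 2)).sqrt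

lemma hasDerivAt_height (t : ℝ) : HasDerivAt (profileHeight r) (√(1 - deriv r t ^ 2)) t :=
  hasDerivAt_primitive H.continuous_speed t

lemma one_sub_deriv_sq_pos {t : ℝ} (ht : t ∈ Set.Ioo (-c) c) : 0 < 1 - deriv r t ^ 2 := by
  have := H.deriv_mem_Ioo ht
  nlinarith [this.1, this.2]

/-- The interval is open because the square root degenerates at the ends, where `r' = ±1`; there the
caps take over. -/
lemma contDiffOn_height : ContDiffOn ℝ ∞ (profileHeight r) (Set.Ioo (-c) c) := by
  rw [contDiffOn_infty_iff_deriv_of_isOpen isOpen_Ioo]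
  refine ⟨fun t _ => (H.hasDerivAt_height t).differentiableAt.differentiableWithinAt, ?_⟩
  rw [show deriv (profileHeight r) = fun s => √(1 - deriv r s ^ 2) from
    funext fun t => (H.hasDerivAt_height t).deriv]
  exact (contDiff_const.sub (H.contDiff_deriv.pow 2)).contDiffOn.sqrt
    fun t ht => (H.one_sub_deriv_sq_pos ht).ne'

lemma height_neg (t : ℝ) : profileHeight r (-t) = -profileHeight r t := by
  unfold profileHeight
  have := intervalIntegral.integral_comp_neg (a := 0) (b := t) (fun s => √(1 - deriv r s ^ 2))
  simp only [H.deriv_neg, neg_zero, neg_sq] at this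
  rw [this, integral_symm]

/-- Near its end the profile curve is an arc of a unit circle. -/
lemma height_tail {t : ℝ} (ht : a₁ < t) (htc : t ≤ c) :
    profileHeight r t = profileHeight r c - 1 + Real.cos (c - t) := by
  have hi := fun x y => H.continuous_speed.intervalIntegrable (μ := volume) x y
  have h1 : (∫ s in t..c, √(1 - deriv r s ^ 2)) = ∫ s in t..c, Real.sin (c - s) := by
    refine intervalIntegral.integral_congr fun s hs => ?_
    rw [Set.uIcc_of_le htc] at hs
    have hs1 : a₁ < s := ht.trans_le hs.1
    have h0 : 0 ≤ Real.sin (c - s) := by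
      rw [← H.tail s hs1.le]
      rcases hs.2.eq_or_lt with h | h
      · rw [h, H.r_c]
      · exact (H.pos s ⟨by linarith [H.a_nonneg, H.c_pos], h⟩).le
    simp only [H.deriv_tail hs1, neg_sq]
    rw [← Real.sin_sq, Real.sqrt_sq h0]
  have h2 : (∫ s in t..c, Real.sin (c - s)) = 1 - Real.cos (c - t) := by
    rw [intervalIntegral.integral_comp_sub_left (fun x => Real.sin x), integral_sin]
    simp
  have h3 := intervalIntegral.integral_add_adjacent_intervals (hi 0 t) (hi t c)
  unfold profileHeight
  linarith

lemma gaussA_neg (z : ℝ) : gaussA c r (-z) = gaussA c r z := by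
  rcases lt_or_ge |z| 1 with hz | hz
  · have hz' := abs_lt.mp hz
    rw [gaussA_of_abs_lt hz, gaussA_of_abs_lt (by rwa [abs_neg]),
      H.angleInv_neg ⟨hz'.1.le, hz'.2.le⟩, H.even, neg_sq]
  · rw [gaussA_of_one_le hz, gaussA_of_one_le (by rwa [abs_neg])]

lemma gaussB_neg (z : ℝ) : gaussB c r (-z) = -gaussB c r z := by
  rcases lt_or_ge |z| 1 with hz | hz
  · have hz' := abs_lt.mp hz
    rw [gaussB_of_abs_lt hz, gaussB_of_abs_lt (by rwa [abs_neg]),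
      H.angleInv_neg ⟨hz'.1.le, hz'.2.le⟩, H.height_neg, H.gaussA_neg]
    ring
  · rw [gaussB, gaussB, if_neg (not_lt.mpr hz), if_neg (by rw [abs_neg]; exact not_lt.mpr hz),
      Left.sign_neg]
    simp

/-- The angle at which the round cap begins. -/
lemma exists_cap_angle : ∃ z₁ : ℝ, 0 ≤ z₁ ∧ z₁ < 1 ∧ ∀ z, z₁ < z →
    gaussA c r z = 1 ∧ gaussB c r z = profileHeight r c - 1 := by
  have hc := H.c_pos
  have ha1 : a₁ ∈ Set.Ioo (-c) c := ⟨by linarith [H.a_nonneg], H.a_lt⟩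
  refine ⟨max 0 (-deriv r a₁), le_max_left _ _, max_lt one_pos (H.deriv_mem_Ioo ha1).2,
    fun z hz => ?_⟩
  have hz0 : 0 < z := (le_max_left _ _).trans_lt hz
  have hz1 : -deriv r a₁ < z := (le_max_right _ _).trans_lt hz
  rcases lt_or_ge z 1 with h | h
  · have hzI : z ∈ Set.Ioo (-1 : ℝ) 1 := ⟨by linarith, h⟩
    have habs : |z| < 1 := abs_lt.mpr hzI
    have ht := H.angleInv_mem_Ioo hzI
    have hspec := (H.angleInv_spec (Set.Ioo_subset_Icc_self hzI)).2
    have hat : a₁ < angleInv c r z := by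
      rw [← hspec] at hz1
      exact (H.strictMonoOn_angle.lt_iff_lt (Set.Ioo_subset_Icc_self ha1)
        (Set.Ioo_subset_Icc_self ht)).mp hz1
    rw [H.deriv_tail hat, neg_neg] at hspec
    have hpos := H.pos _ ht
    rw [H.tail _ hat.le] at hpos
    have hA : gaussA c r z = 1 := by
      rw [gaussA_of_abs_lt habs, H.tail _ hat.le, ← hspec, hspec, ← hspec, ← Real.sin_sq,
        hspec, Real.sqrt_sq hpos.le, div_self hpos.ne']
    refine ⟨hA, ?_⟩
    rw [gaussB_of_abs_lt habs, hA, H.height_tail hat ht.2.le, hspec]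
    ring
  · exact ⟨gaussA_of_one_le (h.trans (le_abs_self z)), gaussB_of_one_le h⟩

lemma gaussA_eventually_one {z : ℝ} (hz : 1 ≤ |z|) : ∀ᶠ y in nhds z, gaussA c r y = 1 := by
  obtain ⟨z₁, h0, h1, h⟩ := H.exists_cap_angle
  rcases le_abs'.mp hz with hz | hz
  · refine Filter.eventually_of_mem (Iio_mem_nhds (show z < -z₁ by linarith)) fun y hy => ?_
    rw [← H.gaussA_neg]
    exact (h (-y) (by linarith [Set.mem_Iio.mp hy])).1
  · exact Filter.eventually_of_mem (Ioi_mem_nhds (show z₁ < z by linarith)) fun y hy => (h y hy).1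

lemma gaussB_eventually_const {z : ℝ} (hz : 1 ≤ |z|) :
    ∃ k : ℝ, ∀ᶠ y in nhds z, gaussB c r y = k := by
  obtain ⟨z₁, h0, h1, h⟩ := H.exists_cap_angle
  rcases le_abs'.mp hz with hz | hz
  · refine ⟨-(profileHeight r c - 1), Filter.eventually_of_mem
      (Iio_mem_nhds (show z < -z₁ by linarith)) fun y hy => ?_⟩
    rw [← (h (-y) (by linarith [Set.mem_Iio.mp hy])).2, H.gaussB_neg, neg_neg]
  · exact ⟨_, Filter.eventually_of_mem (Ioi_mem_nhds (show z₁ < z by linarith))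
      fun y hy => (h y hy).2⟩

lemma contDiff_gaussA : ContDiff ℝ ∞ (gaussA c r) := by
  rw [contDiff_iff_contDiffAt]
  intro z
  rcases lt_or_ge |z| 1 with hz | hz
  · have hzI := abs_lt.mp hz
    have h1 : ContDiffAt ℝ ∞ (fun z => r (angleInv c r z) / √(1 - z ^ 2)) z :=
      (H.smooth.contDiffAt.comp z (H.angleInv_contDiffAt hzI)).div
        ((contDiff_const.sub (contDiff_id.pow 2)).contDiffAt.sqrt (one_sub_sq_pos hz).ne')
        (Real.sqrt_pos.mpr (one_sub_sq_pos hz)).ne'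
    exact h1.congr_of_eventuallyEq (Filter.eventually_of_mem (Ioo_mem_nhds hzI.1 hzI.2)
      fun y hy => gaussA_of_abs_lt (abs_lt.mpr hy))
  · exact contDiffAt_const.congr_of_eventuallyEq (H.gaussA_eventually_one hz)

lemma contDiff_gaussB : ContDiff ℝ ∞ (gaussB c r) := by
  rw [contDiff_iff_contDiffAt]
  intro z
  rcases lt_or_ge |z| 1 with hz | hz
  · have hzI := abs_lt.mp hz
    have ht := H.angleInv_mem_Ioo hzI
    have h1 : ContDiffAt ℝ ∞ (fun z => profileHeight r (angleInv c r z) - gaussA c r z * z) z :=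
      (((H.contDiffOn_height _ ht).contDiffAt (Ioo_mem_nhds ht.1 ht.2)).comp z
        (H.angleInv_contDiffAt hzI)).sub (H.contDiff_gaussA.contDiffAt.mul contDiffAt_id)
    exact h1.congr_of_eventuallyEq (Filter.eventually_of_mem (Ioo_mem_nhds hzI.1 hzI.2)
      fun y hy => gaussB_of_abs_lt (abs_lt.mpr hy))
  · obtain ⟨k, hk⟩ := H.gaussB_eventually_const hz
    exact contDiffAt_const.congr_of_eventuallyEq hk

lemma deriv_gaussA_eq_zero {z : ℝ} (hz : 1 ≤ |z|) : deriv (gaussA c r) z = 0 := by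
  rw [Filter.EventuallyEq.deriv_eq (f := fun _ => (1 : ℝ)) (H.gaussA_eventually_one hz)]
  simp

lemma deriv_gaussB_eq_zero {z : ℝ} (hz : 1 ≤ |z|) : deriv (gaussB c r) z = 0 := by
  obtain ⟨k, hk⟩ := H.gaussB_eventually_const hz
  rw [Filter.EventuallyEq.deriv_eq (f := fun _ => k) hk]
  simp

/-- The derivatives of the two coefficients, with `q = √(1 - z²)` and `D = 1 / (-r'')`. -/
lemma derivs_of_abs_lt {z : ℝ} (hz : |z| < 1) :
    (1 - z ^ 2) * deriv (gaussB c r) z =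
      √(1 - z ^ 2) * (-deriv (deriv r) (angleInv c r z))⁻¹ - gaussA c r z ∧
    deriv (gaussA c r) z = -z * deriv (gaussB c r) z := by
  have hzI := abs_lt.mp hz
  have hq2 := one_sub_sq_pos hz
  set q := √(1 - z ^ 2) with hq
  have hq0 : 0 < q := Real.sqrt_pos.mpr hq2
  have hqq : q ^ 2 = 1 - z ^ 2 := Real.sq_sqrt hq2.le
  set t := angleInv c r z with ht
  set D := (-deriv (deriv r) t)⁻¹ with hD
  have hspec : -deriv r t = z := (H.angleInv_spec ⟨hzI.1.le, hzI.2.le⟩).2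
  have hτ : HasDerivAt (angleInv c r) D z := H.hasDerivAt_angleInv hzI
  have hA := (H.contDiff_gaussA.differentiable (by simp) z).hasDerivAt
  have hB := (H.contDiff_gaussB.differentiable (by simp) z).hasDerivAt
  have hmem : ∀ᶠ y in nhds z, |y| < 1 := Filter.eventually_of_mem (Ioo_mem_nhds hzI.1 hzI.2)
    fun y hy => abs_lt.mpr hy
  have hsq : HasDerivAt (fun y : ℝ => √(1 - y ^ 2)) (-(z / q)) z := by
    have h1 : HasDerivAt (fun y : ℝ => 1 - y ^ 2) (-(2 * z)) z := by
      have := ((hasDerivAt_id z).pow 2).const_sub 1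
      refine this.congr_deriv ?_
      simp
    refine (h1.sqrt hq2.ne').congr_deriv ?_
    rw [← hq]
    field_simp
  -- The derivatives come from differentiating `a √(1 - z²) = r ∘ τ` and `a z + b = height ∘ τ`,
  -- with `τ` the inverse angle, and solving the resulting linear system.
  have e1 : deriv (gaussA c r) z * q + gaussA c r z * (-(z / q)) = deriv r t * D := by
    have h1 := hA.fun_mul hsq
    have h2 := (H.hasDerivAt t).comp z hτ
    have h3 : (fun y => gaussA c r y * √(1 - y ^ 2)) =ᶠ[nhds z] r ∘ angleInv c r := by
      filter_upwards [hmem] with y hy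
      rw [gaussA_of_abs_lt hy, div_mul_cancel₀ _ (Real.sqrt_pos.mpr (one_sub_sq_pos hy)).ne']
      rfl
    exact (h3.hasDerivAt_iff.mp h1).unique h2
  have e2 : deriv (gaussA c r) z * z + gaussA c r z * 1 + deriv (gaussB c r) z = q * D := by
    have h1 := (hA.fun_mul (hasDerivAt_id z)).fun_add hB
    have h2 := (H.hasDerivAt_height t).comp z hτ
    have h3 : (fun y => gaussA c r y * id y + gaussB c r y) =ᶠ[nhds z]
        profileHeight r ∘ angleInv c r := by
      filter_upwards [hmem] with y hy
      rw [gaussB_of_abs_lt hy]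
      simp
    have h4 : deriv r t ^ 2 = z ^ 2 := by rw [← hspec]; ring
    rw [h4] at h2
    exact (h3.hasDerivAt_iff.mp h1).unique h2
  have hr : deriv r t = -z := by linarith
  rw [hr] at e1
  have e3 : deriv (gaussA c r) z * (1 - z ^ 2) = z * gaussA c r z - z * D * q := by
    rw [← hqq]
    field_simp at e1
    linear_combination e1
  have e4 : (1 - z ^ 2) * deriv (gaussB c r) z = q * D - gaussA c r z := by
    linear_combination (1 - z ^ 2) * e2 - z * e3
  refine ⟨e4, ?_⟩
  apply mul_right_cancel₀ hq2.ne'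
  linear_combination e3 + z * e4

/-- For `|z| < 1` the principal radii are `r / q` and `q / (-r'')` with `q = √(1 - r'²)`. The first
is at most `1` by `r² + r'² ≤ 1`, and their product `r / (-r'')` is at most `1` by `r'' + r ≤ 0`.
For `|z| ≥ 1` both equal `1`. -/
lemma isGaussProfile : IsGaussProfile (gaussA c r) (gaussB c r) where
  smooth_a := H.contDiff_gaussA
  smooth_b := H.contDiff_gaussB
  deriv_a z _ := by
    rcases lt_or_ge |z| 1 with hz | hz
    · exact (H.derivs_of_abs_lt hz).2
    · rw [H.deriv_gaussA_eq_zero hz, H.deriv_gaussB_eq_zero hz, mul_zero]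
  a_pos z _ := by
    rcases lt_or_ge |z| 1 with hz | hz
    · rw [gaussA_of_abs_lt hz]
      exact div_pos (H.pos _ (H.angleInv_mem_Ioo (abs_lt.mp hz)))
        (Real.sqrt_pos.mpr (one_sub_sq_pos hz))
    · rw [gaussA_of_one_le hz]; exact one_pos
  a_le_one z hzI := by
    rcases lt_or_ge |z| 1 with hz | hz
    · rw [gaussA_of_abs_lt hz, div_le_one (Real.sqrt_pos.mpr (one_sub_sq_pos hz))]
      have hspec := H.angleInv_spec hzI
      have := H.sq_add_deriv_sq_le hspec.1
      apply Real.le_sqrt_of_sq_le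
      have h4 : deriv r (angleInv c r z) ^ 2 = z ^ 2 := by
        conv_rhs => rw [← hspec.2]
        ring
      linarith
    · rw [gaussA_of_one_le hz]
  meridian_pos z _ := by
    rcases lt_or_ge |z| 1 with hz | hz
    · have h1 := (H.derivs_of_abs_lt hz).1
      have h2 := H.deriv_deriv_neg (H.angleInv_mem_Ioo (abs_lt.mp hz))
      have h3 : 0 < √(1 - z ^ 2) * (-deriv (deriv r) (angleInv c r z))⁻¹ :=
        mul_pos (Real.sqrt_pos.mpr (one_sub_sq_pos hz)) (inv_pos.mpr (by linarith))
      linarith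
    · rw [gaussA_of_one_le hz, H.deriv_gaussB_eq_zero hz]
      norm_num
  mul_le_one z _ := by
    rcases lt_or_ge |z| 1 with hz | hz
    · have h1 := (H.derivs_of_abs_lt hz).1
      have ht := H.angleInv_mem_Ioo (abs_lt.mp hz)
      have h2 := H.deriv_deriv_neg ht
      have h3 := H.ode _ (Set.Ioo_subset_Icc_self ht)
      have hq := Real.sqrt_pos.mpr (one_sub_sq_pos hz)
      have h4 : gaussA c r z + deriv (gaussB c r) z * (1 - z ^ 2) =
          √(1 - z ^ 2) * (-deriv (deriv r) (angleInv c r z))⁻¹ := by linarith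
      rw [h4, gaussA_of_abs_lt hz, ← mul_assoc, div_mul_cancel₀ _ hq.ne', ← div_eq_mul_inv,
        div_le_one (by linarith)]
      linarith
    · rw [gaussA_of_one_le hz, H.deriv_gaussB_eq_zero hz]
      norm_num
  deriv_b_eq_zero z hz := H.deriv_gaussB_eq_zero (by
    rw [← sq_abs] at hz
    nlinarith [abs_nonneg z])

lemma profile_point {z : ℝ} (hz : z ∈ Set.Icc (-1 : ℝ) 1) :
    gaussA c r z ^ 2 * (1 - z ^ 2) = r (angleInv c r z) ^ 2 ∧
      gaussA c r z * z + gaussB c r z = profileHeight r (angleInv c r z) := by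
  rcases lt_or_ge |z| 1 with h | h
  · refine ⟨?_, ?_⟩
    · have hq := one_sub_sq_pos h
      rw [gaussA_of_abs_lt h, div_pow, Real.sq_sqrt hq.le, div_mul_cancel₀ _ hq.ne']
    · rw [gaussB_of_abs_lt h]
      ring
  · have h1 : gaussA c r 1 ^ 2 * (1 - 1 ^ 2) = r (angleInv c r 1) ^ 2 := by
      rw [H.angleInv_one, H.r_c]; norm_num
    have h2 : gaussA c r 1 * 1 + gaussB c r 1 = profileHeight r (angleInv c r 1) := by
      rw [H.angleInv_one, gaussA_of_one_le (by simp), gaussB_of_one_le le_rfl]; ring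
    rcases le_abs'.mp h with h' | h'
    · obtain rfl : z = -1 := le_antisymm h' hz.1
      rw [H.gaussA_neg, H.gaussB_neg, H.angleInv_neg ⟨by norm_num, le_rfl⟩, H.even, H.height_neg,
        ← h2, ← h1]
      constructor <;> ring
    · obtain rfl : z = 1 := le_antisymm hz.2 h'
      exact ⟨h1, h2⟩

lemma range_gaussInv (n : ℕ) :
    Set.range (gaussInv n (gaussA c r) (gaussB c r)) = hypersurfaceOfRevolution n c r := by
  refine _root_.range_gaussInv H.isGaussProfile (fun z hz => ?_) fun t ht => ?_
  · exact ⟨_, (H.angleInv_spec hz).1, H.profile_point hz⟩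
  · refine ⟨_, H.deriv_mem_Icc ht, ?_⟩
    have := H.profile_point (H.deriv_mem_Icc ht)
    rw [H.angleInv_angle ht] at this
    exact this

lemma two_mul_height_le_diam (n : ℕ) :
    2 * profileHeight r c ≤ diamOfEmbedding (gaussInv n (gaussA c r) (gaussB c r)) := by
  refine le_trans (le_of_eq ?_) (height_sub_le_diam H.isGaussProfile)
  rw [H.gaussA_neg, H.gaussB_neg, gaussA_of_one_le (by simp), gaussB_of_one_le le_rfl]
  ring
end
end IsRoundEndedProfile
end

/-! ### The height estimate and the choice of constants. -/

noncomputable section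

open MeasureTheory intervalIntegral

/-- The height of the profile is at least `a √(1 - 1/A²)` if its slope is at most `1/A` on
`(0, a)`. -/
lemma IsRoundEndedProfile.le_height {c a₁ a A : ℝ} {r : ℝ → ℝ} (H : IsRoundEndedProfile c a₁ r)
    (ha : 0 ≤ a) (hac : a ≤ c) (hA : 1 ≤ A) (hr : ∀ t ∈ Set.Ioo 0 a, |deriv r t| ≤ 1 / A) :
    a * (1 - 1 / A ^ 2) ≤ profileHeight r c := by
  have hi : ∀ x y, IntervalIntegrable (fun s => √(1 - deriv r s ^ 2)) volume x y :=
    fun x y => H.continuous_speed.intervalIntegrable x y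
  have h1 : (∫ _ in (0 : ℝ)..a, (1 - 1 / A ^ 2)) ≤ ∫ s in (0 : ℝ)..a, √(1 - deriv r s ^ 2) := by
    refine intervalIntegral.integral_mono_on_of_le_Ioo ha (by simp) (hi _ _) fun s hs => ?_
    have h2 : deriv r s ^ 2 ≤ 1 / A ^ 2 := by
      rw [← sq_abs, ← one_div_pow]
      exact pow_le_pow_left₀ (abs_nonneg _) (hr s hs) 2
    have h3 : 1 / A ^ 2 ≤ 1 := by
      rw [div_le_one (by positivity)]
      nlinarith
    have h4 : 0 ≤ 1 / A ^ 2 := by positivity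
    apply Real.le_sqrt_of_sq_le
    nlinarith
  have h2 : 0 ≤ ∫ s in a..c, √(1 - deriv r s ^ 2) :=
    intervalIntegral.integral_nonneg hac fun s _ => Real.sqrt_nonneg _
  have h3 := intervalIntegral.integral_add_adjacent_intervals (hi 0 a) (hi a c)
  rw [intervalIntegral.integral_const, smul_eq_mul, sub_zero] at h1
  unfold profileHeight
  linarith

end
theorem mainTheorem4 (n : ℕ) (hn : 2 ≤ n) (ε : ℝ) (hε : 0 < ε) :
    ∃ (g : SmoothRiemMetric n (UnitSph n)) (F : UnitSph n → EucSp (n + 1)),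
      IsSmoothIsometricEmbedding g F ∧
      SectionalCurvatureGE g 1 ∧
      Real.pi - ε ≤ diamOfEmbedding F ∧
      IsRotationallySymmetric g ∧
      IsRotationallyEquivariant F ∧
      ∃ (c : ℝ) (h f : ℝ → ℝ),
        IsCutoffProfile ε c h f ∧
        deriv (rescaledProfile c f) c = -1 ∧
        (∀ t ∈ Set.Icc (-c) c, |deriv (rescaledProfile c f) t| ≤ 1) ∧
        Set.range F = hypersurfaceOfRevolution n c (rescaledProfile c f) := by
  -- The cap at `1` keeps `π/2 - δ/4` positive and the amplitude at least `8`.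
  set δ := min ε 1 with hδ
  have hδ0 : 0 < δ := lt_min hε one_pos
  have hδε : δ ≤ ε := min_le_left _ _
  have hδ1 : δ ≤ 1 := min_le_right _ _
  have hπ := Real.pi_gt_three
  have hπ4 := Real.pi_le_four
  -- With `a = π/2 - δ/4` and `A ≥ 8/δ`, twice the height is at least `2a (1 - 1/A²)`. Shortening
  -- `a` costs `δ/2`, and the factor costs at most `4 · δ/64`, as `2a ≤ 4` and `1/A² ≤ δ/64`; the
  -- total is less than `δ`.
  obtain ⟨c, A, a₁, h, f, hh, hneg, hev, hsupp, haa₁, ha₁c, hcπ, hf, hode, hf0, hf0', hfev, hfpos,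
    hΛA, htail, hcosf⟩ := exists_oscSol_steep (Real.pi / 2 - δ / 4) (8 / δ) (by linarith)
      (by linarith) (by positivity)
  set a := Real.pi / 2 - δ / 4 with ha
  have hA8 : 8 ≤ A := le_trans (by rw [le_div_iff₀ hδ0]; linarith) hΛA
  have hA0 : 0 < A := by linarith
  have hdc : deriv f c = -A := by
    have h1 : f =ᶠ[nhds c] fun t => A * Real.sin (c - t) :=
      Filter.eventually_of_mem (Ioi_mem_nhds ha₁c) fun s hs => htail s (le_of_lt hs)
    have h2 : HasDerivAt (fun t => A * Real.sin (c - t)) (A * (Real.cos (c - c) * (-1))) c :=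
      (((hasDerivAt_id c).const_sub c).sin).const_mul A
    rw [h1.deriv_eq, h2.deriv]
    simp
  have hr : rescaledProfile c f = fun t => f t / A := by
    funext t
    rw [rescaledProfile, hdc, abs_neg, abs_of_pos hA0]
  have hdr : deriv (rescaledProfile c f) = fun t => deriv f t / A := by
    rw [hr]
    funext t
    exact deriv_div_const A
  have H : IsRoundEndedProfile c a₁ (rescaledProfile c f) :=
    { a_nonneg := by linarith
      a_lt := ha₁c
      smooth := by rw [hr]; exact hf.div_const A
      even := fun t => by simp only [hr, hfev]
      pos := fun t ht => by rw [hr]; exact div_pos (hfpos t ht) hA0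
      ode := fun t _ => by
        rw [hdr, hr, deriv_div_const, ← add_div, hode]
        exact div_nonpos_of_nonpos_of_nonneg (hneg t) hA0.le
      tail := fun t ht => by
        rw [hr]
        simp only [htail t ht]
        field_simp }
  refine ⟨revMetric n H.isGaussProfile, gaussInv n _ _,
    isSmoothIsometricEmbedding_gaussInv H.isGaussProfile,
    sectionalCurvatureGE_revMetric H.isGaussProfile, ?_,
    isRotationallySymmetric_revMetric H.isGaussProfile, isRotationallyEquivariant_gaussInv,
    c, h, f, ?_, H.deriv_c, ?_, H.range_gaussInv n⟩
  · refine le_trans ?_ (H.two_mul_height_le_diam n)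
    have h1 := H.le_height (a := a) (A := A) (by linarith) (by linarith) (by linarith)
      fun t ht => by
        have h2 : f =ᶠ[nhds t] Real.cos := Filter.eventually_of_mem (Ioo_mem_nhds ht.1 ht.2)
          fun s hs => hcosf s (Set.Ioo_subset_Icc_self hs)
        rw [hdr]
        simp only
        rw [h2.deriv_eq, Real.deriv_cos, abs_div, abs_of_pos hA0, abs_neg]
        exact div_le_div_of_nonneg_right (Real.abs_sin_le_one t) hA0.le
    have h2 : 1 / A ^ 2 ≤ δ / 64 := by
      rw [div_le_div_iff₀ (by positivity) (by norm_num)]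
      have h3 : 8 ≤ A * δ := (div_le_iff₀ hδ0).mp hΛA
      nlinarith
    have h4 : 0 ≤ 1 / A ^ 2 := by positivity
    nlinarith
  · exact
      { c_pos := H.c_pos
        h_smooth := hh
        h_nonpos := hneg
        h_even := hev
        h_support := by
          have hcl : IsClosed {t : ℝ | a ≤ |t| ∧ |t| ≤ a₁} :=
            (isClosed_le continuous_const continuous_abs).inter
              (isClosed_le continuous_abs continuous_const)
          -- The closed support may touch `|t| = a` and `|t| = a₁`, which is harmless because `0 <
          -- a`, `π/2 - ε ≤ a` and `a₁ < c`.
          refine (closure_minimal (fun t ht => ?_) hcl).trans fun t ht => ?_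
          · exact ⟨(hsupp t ht).1.le, (hsupp t ht).2.le⟩
          · exact ⟨by linarith [ht.1], by linarith [ht.1], by linarith [ht.2]⟩
        f_smooth := hf
        ode := hode
        f_zero := hf0
        deriv_f_zero := hf0'
        f_pos := hfpos
        f_end := by simp [htail c ha₁c.le] }
  · intro t ht
    have := H.deriv_mem_Icc ht
    exact abs_le.mpr ⟨by linarith [this.2], by linarith [this.1]⟩
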